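/- Let $f_1,\dots,f_k\in\mathbb{C}[p_0,\dots,p_n]$ be homogeneous polynomials defining an irreducible, generically reduced $X\subset\mathbb{P}^n$, and let $X'\subset\mathbb{P}^{n+1}$, with coordinates $p_0,\dots,p_n,p_s$, be defined by $f_1,\dots,f_k$ and $p_s-p_0-\dots-p_n$. Let $N_{X'}\subset\mathbb{P}^{n+1}\times\mathbb{P}^{n+1}$ be the Zariski closure of $\{(p,b): p\in X'_{reg},\ b\perp T_pX'\}$, and let the dual variety $X'^*$, with coordinates $b_0,\dots,b_n,b_s$, be the projection of $N_{X'}$ to the second factor. For data $u\in(\mathbb{C}^*)^{n+1}$ with $u_+:=u_0+\dots+u_n\neq 0$, put $$l'_u(x)=x_0^{u_0}\cdots x_n^{u_n}x_s^{-u_+}.$$ For $Y=X'$ or $Y=X'^*$, a critical point of $l'_u$ on $Y$ is a regular point $x$ of $Y$ with all coordinates nonzero such that the gradient $[u_0/x_0:\dots:u_n/x_n:-u_+/x_s]$ of $l'_u$ at $x$ is orthogonal to the tangent space $T_xY$. For $p\in X'$ and $b\in X'^*$ consider the relation $$[p_0b_0:\dots:p_nb_n:p_sb_s]=[u_0:\dots:u_n:-u_+].\qquad(*)$$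 (1) For generic $u$ (all $u$ as above outside the zero set of some nonzero polynomial in $u_0,\dots,u_n$ that depends only on the $f_j$), the relation $(*)$ is the graph of a bijection between the critical points of $l'_u(p)$ on $X'$ and the critical points of $l'_u(b)$ on $X'^*$. (2) For every $u$ as above: if $p\in X'_{reg}$ and $b\in (X'^*)_{reg}$ satisfy $(*)$, then $p$ is a critical point of $l'_u(p)$ on $X'$ if and only if $b$ is a critical point of $l'_u(b)$ on $X'^*$. (3) For every $u$ as above and all critical points $p$ of $l'_u(p)$ on $X'$ and $b$ of $l'_u(b)$ on $X'^*$ that satisfy $(*)$, the product is the constant $$l'_u(p)\,l'_u(b)=u_0^{u_0}\cdots u_n^{u_n}(-u_+)^{-u_+}.$$ For integer data this is an equality of numbers. For complex $u$ it is an equality of sets of values of multivalued functions: a monomial $x^w$ takes the values $\exp(\sum_i w_i\alpha_i)$ for all choices of logarithms $\alpha_i$ of the $x_i$. -/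

import Mathlib

open scoped LinearAlgebra.Projectivization

noncomputable section

namespace MLDual

variable {σ : Type} [Fintype σ]

/-- The complex projective space with homogeneous coordinates indexed by `σ`. It is also used as
the dual projective space, a point `q` of which is the hyperplane `∑ i, q i * x i = 0`. -/
abbrev PSpace (σ : Type) : Type := ℙ ℂ (σ → ℂ)

/-- The polynomial `f` is homogeneous of some degree. -/
def IsHomog (f : MvPolynomial σ ℂ) : Prop := ∃ d : ℕ, f.IsHomogeneous d

/-- The projective zero locus of a set of homogeneous polynomials (for a homogeneous polynomial the
choice of homogeneous coordinates of the point is irrelevant). -/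
def zeroLocus (S : Set (MvPolynomial σ ℂ)) : Set (PSpace σ) :=
  {p | ∀ f ∈ S, MvPolynomial.eval p.rep f = 0}

/-- The homogeneous polynomials that vanish on a set of points of projective space. They generate
the homogeneous vanishing ideal, and their zero locus is the Zariski closure of the set. -/
def vanishingForms (Y : Set (PSpace σ)) : Set (MvPolynomial σ ℂ) :=
  {f | IsHomog f ∧ ∀ p ∈ Y, MvPolynomial.eval p.rep f = 0}

/-- Zariski closed subsets of projective space. -/
def IsZariskiClosed (Y : Set (PSpace σ)) : Prop :=
  ∃ S : Set (MvPolynomial σ ℂ), (∀ f ∈ S, IsHomog f) ∧ Y = zeroLocus S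

/-- Irreducibility in the Zariski topology: nonempty, and not covered by two closed sets neither of
which contains it. -/
def IsIrred (Y : Set (PSpace σ)) : Prop :=
  Y.Nonempty ∧ ∀ A B : Set (PSpace σ), IsZariskiClosed A → IsZariskiClosed B →
    Y ⊆ A ∪ B → Y ⊆ A ∨ Y ⊆ B

/-- The scheme defined by the homogeneous polynomials `S` (with irreducible zero locus) is
generically reduced: on some nonempty open subset `g ≠ 0` of it, every form that vanishes on the
zero locus lies in the (localized) ideal generated by `S`. -/
def IsGenericallyReduced (S : Set (MvPolynomial σ ℂ)) : Prop :=
  ∃ g : MvPolynomial σ ℂ, IsHomog g ∧ (∃ p ∈ zeroLocus S, MvPolynomial.eval p.rep g ≠ 0) ∧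
    ∀ h ∈ vanishingForms (zeroLocus S), g * h ∈ Ideal.span S

/-- The tangent space at `p` of the projective scheme defined by the homogeneous polynomials `S`,
as a linear subspace of the affine space (that is, the tangent space of the affine cone): the
kernel of the Jacobian matrix of `S` at `p`. -/
def tangentSpace (S : Set (MvPolynomial σ ℂ)) (p : PSpace σ) : Submodule ℂ (σ → ℂ) where
  carrier := {t | ∀ f ∈ S, ∑ i, MvPolynomial.eval p.rep (MvPolynomial.pderiv i f) * t i = 0}
  zero_mem' := by
    intro f _
    simp
  add_mem' := by
    intro a b ha hb f hf
    simp only [Pi.add_apply, mul_add, Finset.sum_add_distrib]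
    rw [ha f hf, hb f hf, add_zero]
  smul_mem' := by
    intro c a ha f hf
    have h : ∑ i, MvPolynomial.eval p.rep (MvPolynomial.pderiv i f) * (c • a) i
        = c * ∑ i, MvPolynomial.eval p.rep (MvPolynomial.pderiv i f) * a i := by
      rw [Finset.mul_sum]
      refine Finset.sum_congr rfl fun i _ => ?_
      simp only [Pi.smul_apply, smul_eq_mul]
      ring
    rw [h, ha f hf, mul_zero]

/-- `p` is a regular point of the (irreducible) variety defined by the homogeneous polynomials `S`:
the dimension of the tangent space is that of the variety. Both dimensions are those of the affine
cone; equivalently, the rank of the Jacobian matrix at `p` is the codimension. -/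
def IsRegularPoint (S : Set (MvPolynomial σ ℂ)) (p : PSpace σ) : Prop :=
  p ∈ zeroLocus S ∧
    ((Module.finrank ℂ (tangentSpace S p) : ℕ) : WithBot ℕ∞) =
      ringKrullDim (MvPolynomial σ ℂ ⧸ Ideal.span S)

/-- The vector `v` is orthogonal to the tangent space at `p`, for the bilinear (not Hermitian)
pairing `∑ i, v i * t i`. -/
def PerpTangent (S : Set (MvPolynomial σ ℂ)) (p : PSpace σ) (v : σ → ℂ) : Prop :=
  ∀ t ∈ tangentSpace S p, ∑ i, v i * t i = 0

/-- Bihomogeneous polynomials in two groups of variables, both indexed by `σ`. -/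
def IsBihomog (F : MvPolynomial (σ ⊕ σ) ℂ) : Prop :=
  ∃ d e : ℕ, MvPolynomial.IsWeightedHomogeneous
    (Sum.elim (fun _ => ((1, 0) : ℕ × ℕ)) (fun _ => ((0, 1) : ℕ × ℕ))) F (d, e)

/-- Zariski closure in the product of two projective spaces. -/
def biClosure (Z : Set (PSpace σ × PSpace σ)) : Set (PSpace σ × PSpace σ) :=
  {z | ∀ F : MvPolynomial (σ ⊕ σ) ℂ, IsBihomog F →
    (∀ y ∈ Z, MvPolynomial.eval (Sum.elim y.1.rep y.2.rep) F = 0) →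
    MvPolynomial.eval (Sum.elim z.1.rep z.2.rep) F = 0}

/-- The conormal variety: the Zariski closure of the set of pairs `(p, q)` where `p` is a regular
point and `q` is orthogonal to the tangent space at `p`. -/
def conormalVariety (S : Set (MvPolynomial σ ℂ)) : Set (PSpace σ × PSpace σ) :=
  biClosure {z | IsRegularPoint S z.1 ∧ PerpTangent S z.1 z.2.rep}

/-- The dual variety: the projection of the conormal variety to the dual projective space. -/
def dualVariety (S : Set (MvPolynomial σ ℂ)) : Set (PSpace σ) :=
  Prod.snd '' conormalVariety S

/-- The defining equations of the dual variety: all homogeneous polynomials vanishing on it. -/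
def dualEquations (S : Set (MvPolynomial σ ℂ)) : Set (MvPolynomial σ ℂ) :=
  vanishingForms (dualVariety S)

/-- `p` is a critical point of the monomial `∏ i, x i ^ w i` (complex exponents) on the variety
defined by `S`: a regular point with nonzero coordinates at which the gradient, which is
`(w i / p i)` up to a nonzero factor, is orthogonal to the tangent space. -/
def IsCriticalPoint (S : Set (MvPolynomial σ ℂ)) (w : σ → ℂ) (p : PSpace σ) : Prop :=
  IsRegularPoint S p ∧ (∀ i, p.rep i ≠ 0) ∧ PerpTangent S p (fun i => w i / p.rep i)

/-- The coordinatewise product of `p` and `b` is `w`, as points of projective space. -/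
def ProductRel (w : σ → ℂ) (p b : PSpace σ) : Prop :=
  ∃ c : ℂ, c ≠ 0 ∧ ∀ i, p.rep i * b.rep i = c * w i

/-- The set of all values of the multivalued monomial `∏ i, x i ^ w i` with complex exponents `w`,
one for each choice of logarithms of the coordinates. If the exponents sum to zero, then it does
not change when `x` is multiplied by a nonzero scalar. -/
def monomialValues (w x : σ → ℂ) : Set ℂ :=
  {z | ∃ α : σ → ℂ, (∀ i, Complex.exp (α i) = x i) ∧ z = Complex.exp (∑ i, w i * α i)}

/-- For every choice `ℓ` of logarithms of the coordinates near `x`, differentiable at `x`, the resulting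
branch of the monomial `∏ i, x i ^ w i` has gradient `(w i / x i)` times its value: this is the
gradient in the definition of critical points. -/
theorem hasFDerivAt_monomial_branch (w x : σ → ℂ) (ℓ : σ → ℂ → ℂ)
    (hd : ∀ i, DifferentiableAt ℂ (ℓ i) (x i))
    (hl : ∀ i, ∀ᶠ z in nhds (x i), Complex.exp (ℓ i z) = z) :
    HasFDerivAt (fun y : σ → ℂ => Complex.exp (∑ i, w i * ℓ i (y i)))
      (Complex.exp (∑ i, w i * ℓ i (x i)) •
        ∑ i, (w i / x i) • (ContinuousLinearMap.proj i : (σ → ℂ) →L[ℂ] ℂ)) x := by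
  have key : ∀ i, HasDerivAt (ℓ i) (1 / x i) (x i) := by
    intro i
    have h1 := (hd i).hasDerivAt
    have h2 := h1.cexp
    have h3 : HasDerivAt (fun z : ℂ => Complex.exp (ℓ i z)) 1 (x i) :=
      (hasDerivAt_id (x i)).congr_of_eventuallyEq (hl i)
    have h4 := h2.unique h3
    rw [(hl i).self_of_nhds] at h4
    have h5 : deriv (ℓ i) (x i) = 1 / x i := by
      have hx : x i ≠ 0 := left_ne_zero_of_mul (by rw [h4]; exact one_ne_zero)
      field_simp
      linear_combination h4
    rwa [h5] at h1
  refine HasFDerivAt.cexp ?_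
  refine HasFDerivAt.fun_sum fun i _ => ?_
  have h6 := ((key i).comp_hasFDerivAt x
    ((ContinuousLinearMap.proj i : (σ → ℂ) →L[ℂ] ℂ).hasFDerivAt)).const_mul (w i)
  rw [smul_smul, mul_one_div] at h6
  exact h6

/-- If `X` in `ℙ^n` is defined by the polynomials `f`, then `X'` in `ℙ^(n+1)` (the last coordinate
is `p_s`) is defined by the same polynomials in the first `n+1` coordinates together with
`H = -p_0 - ⋯ - p_n + p_s`. -/
def primeEquations {n k : ℕ} (f : Fin k → MvPolynomial (Fin (n + 1)) ℂ) :
    Set (MvPolynomial (Fin (n + 2)) ℂ) :=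
  Set.range (fun j => MvPolynomial.rename Fin.castSucc (f j)) ∪
    {MvPolynomial.X (Fin.last (n + 1)) -
      ∑ i : Fin (n + 1), MvPolynomial.X (Fin.castSucc i)}

/-- The exponent vector `(u_0, …, u_n, -u_+)`. -/
def weights {n : ℕ} (u : Fin (n + 1) → ℂ) : Fin (n + 2) → ℂ :=
  Fin.snoc (α := fun _ => ℂ) u (-∑ i, u i)

end MLDual

end

/-!
Let `x` be the generic point of the cone over `X'` and `y` a generic vector of the conormal space
at `x`, both with coordinates in one extension field `E` of `ℂ`; then `y` is the generic point of
the cone over the dual variety. A derivation of `E` over `ℂ` annihilates every equation of `x`, so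
its value on `x` is tangent, and differentiating `∑ i, x i * y i = 0` shows that `x` is conormal
at `y` (reflexivity). Over a regular point the conormal variety is the whole space spanned by the
gradients of the equations, so `p` and `b` are critical exactly when `(p, b)` lies on the conormal
variety, a condition symmetric in the two points. By homogeneity the products `x i * y i` lie on
the hyperplane `∑ i, w i = 0`, and the conormal variety has projective dimension one less than
its ambient factors. The products of pairs with a non-regular component therefore satisfy a
nontrivial equation, which the generic data avoid.
-/

noncomputable section

namespace MLDual

open MvPolynomial

section KrullDim

variable {R S : Type*} [CommRing R] [CommRing S] [Algebra R S] [Algebra.IsIntegral R S]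
  [FaithfulSMul R S]

theorem exists_ltSeries_comap_last_eq (l : LTSeries (PrimeSpectrum R)) :
    ∃ L : LTSeries (PrimeSpectrum S), L.length = l.length ∧
      PrimeSpectrum.comap (algebraMap R S) L.last = l.last := by
  induction l using RelSeries.inductionOn' with
  | singleton x =>
    obtain ⟨y, hy⟩ := Algebra.IsIntegral.comap_surjective R S x
    exact ⟨RelSeries.singleton _ y, rfl, by simpa using hy⟩
  | snoc p x hx ih =>
    obtain ⟨L, hL, hlast⟩ := ih
    have hlt : p.last < x := hx
    obtain ⟨Q, hLQ, hQ, hQx⟩ := Ideal.exists_ideal_over_prime_of_isIntegral_of_isPrime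
      x.asIdeal L.last.asIdeal ((congrArg PrimeSpectrum.asIdeal hlast).trans_le hlt.le)
    have hcomap : PrimeSpectrum.comap (algebraMap R S) ⟨Q, hQ⟩ = x := PrimeSpectrum.ext hQx
    have hltQ : L.last < ⟨Q, hQ⟩ :=
      lt_of_le_of_ne hLQ fun h => hlt.ne (by rw [← hlast, h, hcomap])
    exact ⟨L.snoc ⟨Q, hQ⟩ hltQ, congrArg (· + 1) hL, by simpa using hcomap⟩

variable (R S) in
theorem ringKrullDim_eq_of_isIntegral : ringKrullDim R = ringKrullDim S := by
  apply le_antisymm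
  · refine iSup_le fun l => ?_
    obtain ⟨L, hL, -⟩ := exists_ltSeries_comap_last_eq (S := S) l
    exact hL ▸ Order.LTSeries.length_le_krullDim L
  · exact Order.krullDim_le_of_strictMono (PrimeSpectrum.comap (algebraMap R S))
      fun _ _ h => Ideal.IsIntegral.comap_lt_comap (R := R) h

theorem exists_ringKrullDim_eq_and_trdeg_eq (k A : Type*) [Field k] [CommRing A] [IsDomain A]
    [Algebra k A] [Algebra.FiniteType k A] :
    ∃ d : ℕ, ringKrullDim A = d ∧ Algebra.trdeg k A = d := by
  obtain ⟨d, g, hg, hint⟩ := exists_integral_inj_algHom_of_fg k A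
  let := g.toRingHom.toAlgebra
  have : Algebra.IsIntegral (MvPolynomial (Fin d) k) A := ⟨hint⟩
  have : FaithfulSMul (MvPolynomial (Fin d) k) A := (faithfulSMul_iff_algebraMap_injective _ _).2 hg
  have : IsScalarTower k (MvPolynomial (Fin d) k) A :=
    .of_algebraMap_eq fun r => (g.commutes r).symm
  refine ⟨d, ?_, ?_⟩
  · rw [← ringKrullDim_eq_of_isIntegral (MvPolynomial (Fin d) k) A]
    simp [ringKrullDim_eq_zero_of_field]
  · have h := lift_trdeg_add_eq k (MvPolynomial (Fin d) k) (A := A)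
    rw [trdeg_eq_zero (R := MvPolynomial (Fin d) k) (A := A)] at h
    simpa [eq_comm] using h

end KrullDim

section Derivations

theorem formallySmooth_of_charZero (K E : Type*) [Field K] [Field E] [Algebra K E] [CharZero K] :
    Algebra.FormallySmooth K E := by
  obtain ⟨s, hs⟩ := exists_isTranscendenceBasis K E
  have : Algebra.IsAlgebraic (IntermediateField.adjoin K (Set.range ((↑) : s → E))) E :=
    hs.isAlgebraic_field
  exact .of_algebraicIndependent_of_isSeparable hs.1

variable {k A E : Type*} [Field k] [CharZero k] [CommRing A] [Field E] [Algebra k A]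
  [Algebra A E] [FaithfulSMul A E] [Algebra k E] [IsScalarTower k A E]

theorem exists_derivation_algebraMap_eq (D : Derivation k A E) :
    ∃ D' : Derivation k E E, ∀ a, D' (algebraMap A E a) = D a := by
  have : IsDomain A := (FaithfulSMul.algebraMap_injective A E).isDomain
  let := FractionRing.liftAlgebra A E
  have : IsScalarTower k (FractionRing A) E := .to₁₃₄ k A (FractionRing A) E
  have : CharZero (FractionRing A) :=
    charZero_of_injective_algebraMap (algebraMap k (FractionRing A)).injective
  have : Algebra.FormallySmooth A (FractionRing A) := .of_isLocalization (nonZeroDivisors A)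
  have := formallySmooth_of_charZero (FractionRing A) E
  have : Algebra.FormallySmooth A E := .comp A (FractionRing A) E
  have hinj : Function.Injective (KaehlerDifferential.mapBaseChange k A E) := by
    rw [injective_iff_map_eq_zero]
    intro ω hω
    obtain ⟨ω, rfl⟩ := (Algebra.H1Cotangent.exact_δ_mapBaseChange k A E ω).1 hω
    rw [Subsingleton.elim ω 0, map_zero]
  obtain ⟨s, hs⟩ := LinearMap.exists_leftInverse_of_injective _ (LinearMap.ker_eq_bot.2 hinj)
  refine ⟨((D.liftKaehlerDifferential.liftBaseChange E) ∘ₗ s).compDer (KaehlerDifferential.D k E),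
    fun a => ?_⟩
  have hsD : s (KaehlerDifferential.D k E (algebraMap A E a)) =
      1 ⊗ₜ[A] KaehlerDifferential.D k A a := by
    simpa using LinearMap.congr_fun hs (1 ⊗ₜ[A] KaehlerDifferential.D k A a)
  simp [hsD]

theorem derivation_eq_zero_of_isAlgebraic {B A M : Type*} [CommRing B] [IsDomain B] [CharZero B]
    [CommRing A] [IsDomain A] [AddCommGroup M] [Algebra B A] [FaithfulSMul B A] [Module B M]
    [Module A M] [IsScalarTower B A M] [Module.IsTorsionFree A M] (D : Derivation B A M) {a : A}
    (ha : IsAlgebraic B a) : D a = 0 := by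
  obtain ⟨p, hp, hpa⟩ := ha
  induction hn : p.natDegree using Nat.strong_induction_on generalizing p with
  | _ n ih =>
    by_contra hDa
    have hp' : Polynomial.aeval a p.derivative = 0 := by
      simpa [hpa, hDa] using (D.map_aeval p a).symm
    by_cases hd : p.natDegree = 0
    · rw [Polynomial.eq_C_of_natDegree_eq_zero hd] at hpa hp
      simp_all
    · exact hDa (ih _ (hn ▸ Polynomial.natDegree_derivative_lt hd) _
        (mt Polynomial.derivative_eq_zero.1 hd) hp' rfl)

omit [IsScalarTower k A E] in
theorem derivation_eq_zero_of_isTranscendenceBasis {κ : Type*} {b : κ → A}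
    (hb : IsTranscendenceBasis k b) (D : Derivation k A E) (hD : ∀ j, D (b j) = 0) : D = 0 := by
  have : IsDomain A := (FaithfulSMul.algebraMap_injective A E).isDomain
  have : CharZero (Algebra.adjoin k (Set.range b)) :=
    charZero_of_injective_algebraMap (FaithfulSMul.algebraMap_injective k _)
  have hconst : ∀ c ∈ Algebra.adjoin k (Set.range b), D c = 0 :=
    Derivation.eqOn_adjoin (D1 := D) (D2 := 0) (by rintro _ ⟨j, rfl⟩; exact hD j)
  let D' : Derivation (Algebra.adjoin k (Set.range b)) A E := Derivation.mk'
    { toFun := D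
      map_add' := map_add D
      map_smul' := fun c a => by
        simp [Algebra.smul_def, hconst c c.2, IsScalarTower.algebraMap_apply _ A E] }
    D.leibniz
  ext a
  exact derivation_eq_zero_of_isAlgebraic D' (hb.isAlgebraic.isAlgebraic a)

end Derivations

section Perp

variable {σ k : Type*} [Fintype σ] [Field k]

/-- The orthogonal complement for the bilinear (not Hermitian) pairing `v ⬝ᵥ t`. -/
def perp (W : Submodule k (σ → k)) : Submodule k (σ → k) :=
  LinearMap.BilinForm.orthogonal (dotProductBilin k k) W

theorem mem_perp {W : Submodule k (σ → k)} {t : σ → k} : t ∈ perp W ↔ ∀ v ∈ W, v ⬝ᵥ t = 0 :=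
  Iff.rfl

theorem mem_perp_span {s : Set (σ → k)} {t : σ → k} :
    t ∈ perp (Submodule.span k s) ↔ ∀ v ∈ s, v ⬝ᵥ t = 0 :=
  Submodule.span_le (p := LinearMap.ker ((dotProductBilin k k).flip t))

theorem nondegenerate_dotProductBilin :
    (dotProductBilin k k : LinearMap.BilinForm k (σ → k)).Nondegenerate :=
  ⟨fun v hv => dotProduct_eq_zero v hv,
    fun v hv => dotProduct_eq_zero v fun w => (dotProduct_comm v w).trans (hv w)⟩

theorem finrank_add_finrank_perp (W : Submodule k (σ → k)) :
    Module.finrank k W + Module.finrank k (perp W) = Fintype.card σ := by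
  rw [perp, LinearMap.BilinForm.finrank_orthogonal nondegenerate_dotProductBilin,
    ← Module.finrank_fintype_fun_eq_card k, Nat.add_sub_cancel' W.finrank_le]

theorem perp_perp (W : Submodule k (σ → k)) : perp (perp W) = W :=
  LinearMap.BilinForm.orthogonal_orthogonal nondegenerate_dotProductBilin
    (fun v w h => (dotProduct_comm w v).trans h) W

end Perp

section Gradient

variable {σ k A : Type*} [CommSemiring k] [CommSemiring A] [Algebra k A]

/-- The gradient of a polynomial at a point with coordinates in an algebra over the scalars. -/
def grad (h : MvPolynomial σ k) (x : σ → A) : σ → A :=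
  fun i => aeval x (pderiv i h)

theorem grad_mul (f g : MvPolynomial σ k) (x : σ → A) :
    grad (f * g) x = aeval x f • grad g x + aeval x g • grad f x := by
  ext i
  simp [grad]

theorem derivation_aeval [Fintype σ] {M : Type*} [AddCommMonoid M] [Module k M] [Module A M]
    [IsScalarTower k A M] (D : Derivation k A M) (x : σ → A) (h : MvPolynomial σ k) :
    D (aeval x h) = ∑ i, grad h x i • D (x i) := by
  classical
  induction h using MvPolynomial.induction_on with
  | C a => simp [grad]
  | add p q hp hq => simp [hp, hq, grad, add_smul, Finset.sum_add_distrib]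
  | mul_X p i hp =>
    have hpi : ∑ j, aeval x (if i = j then p else 0) • D (x j) = aeval x p • D (x i) := by
      rw [Finset.sum_eq_single i] <;> simp +contextual [eq_comm]
    simp [hp, hpi, add_smul, Finset.sum_add_distrib, Finset.smul_sum, mul_smul, grad, pderiv_X,
      Pi.single_apply]

end Gradient

section ConormalSpace

variable {σ k E : Type*} [Fintype σ] [Field k] [Field E] [Algebra k E]

variable (k) in
/-- The conormal space at a point `x` with coordinates in an extension field: the span of the
gradients of all polynomials that vanish at `x`. If `x` is the generic point of a variety, this is
the orthogonal complement of the tangent space at `x`. -/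
def conormalSpace (x : σ → E) : Submodule E (σ → E) :=
  Submodule.span E {v | ∃ h : MvPolynomial σ k, aeval x h = 0 ∧ grad h x = v}

theorem mem_perp_conormalSpace {x t : σ → E} :
    t ∈ perp (conormalSpace k x) ↔
      ∀ h : MvPolynomial σ k, aeval x h = 0 → grad h x ⬝ᵥ t = 0 := by
  simp [conormalSpace, mem_perp_span]

theorem derivation_mem_perp_conormalSpace (D : Derivation k E E) (x : σ → E) :
    (fun i => D (x i)) ∈ perp (conormalSpace k x) :=
  mem_perp_conormalSpace.2 fun h hh => by simpa [hh, dotProduct] using (derivation_aeval D x h).symm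

omit [Fintype σ] in
theorem conormalSpace_eq_bot {x : σ → E} (hx : AlgebraicIndependent k x) :
    conormalSpace k x = ⊥ := by
  rw [conormalSpace, Submodule.span_eq_bot]
  rintro _ ⟨h, hh, rfl⟩
  rw [(injective_iff_map_eq_zero _).1 hx h hh]
  ext i
  simp [grad]

theorem exists_derivation_range_aeval {x t : σ → E} (ht : t ∈ perp (conormalSpace k x)) :
    ∃ D : Derivation k (aeval x : MvPolynomial σ k →ₐ[k] E).range E,
      ∀ h, D ((aeval x).rangeRestrict h) = grad h x ⬝ᵥ t := by
  obtain ⟨s, hs⟩ := LinearMap.exists_rightInverse_of_surjective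
    (aeval x : MvPolynomial σ k →ₐ[k] E).rangeRestrict.toLinearMap
    (LinearMap.range_eq_top.2 (AlgHom.rangeRestrict_surjective _))
  let φ : MvPolynomial σ k →ₗ[k] E :=
    { toFun := fun h => grad h x ⬝ᵥ t
      map_add' := fun f g => by simp [grad, dotProduct, add_mul, Finset.sum_add_distrib]
      map_smul' := fun c f => by simp [grad, dotProduct, Finset.smul_sum] }
  have hφ : ∀ h, φ (s ((aeval x).rangeRestrict h)) = φ h := fun h => by
    rw [← sub_eq_zero, ← map_sub]
    refine mem_perp_conormalSpace.1 ht _ ?_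
    have := congrArg Subtype.val (LinearMap.congr_fun hs ((aeval x).rangeRestrict h))
    rw [map_sub, sub_eq_zero]
    exact this
  refine ⟨Derivation.mk' (φ ∘ₗ s) fun a b => ?_, hφ⟩
  obtain ⟨f, rfl⟩ := AlgHom.rangeRestrict_surjective _ a
  obtain ⟨g, rfl⟩ := AlgHom.rangeRestrict_surjective _ b
  rw [← map_mul]
  simp only [LinearMap.comp_apply, hφ]
  change grad (f * g) x ⬝ᵥ t = aeval x f * (grad g x ⬝ᵥ t) + aeval x g * (grad f x ⬝ᵥ t)
  rw [grad_mul, add_dotProduct, smul_dotProduct, smul_dotProduct, smul_eq_mul, smul_eq_mul]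

theorem exists_derivation [CharZero k] {x t : σ → E} (ht : t ∈ perp (conormalSpace k x)) :
    ∃ D : Derivation k E E, ∀ i, D (x i) = t i := by
  classical
  obtain ⟨D₀, hD₀⟩ := exists_derivation_range_aeval ht
  obtain ⟨D, hD⟩ := exists_derivation_algebraMap_eq D₀
  refine ⟨D, fun i => ?_⟩
  have := (hD ((aeval x).rangeRestrict (X i))).trans (hD₀ (X i))
  simpa [grad, dotProduct, pderiv_X, Pi.single_apply] using this

theorem card_eq_finrank_perp_conormalSpace [CharZero k] {κ : Type*} [Fintype κ] {x : σ → E}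
    {i : κ → σ}
    (hi : IsTranscendenceBasis k fun j =>
      (aeval x : MvPolynomial σ k →ₐ[k] E).rangeRestrict (X (i j))) :
    Fintype.card κ = Module.finrank E (perp (conormalSpace k x)) := by
  let A := (aeval x : MvPolynomial σ k →ₐ[k] E).range
  let π := (LinearMap.funLeft E E i).domRestrict (perp (conormalSpace k x))
  have hinj : Function.Injective π := (injective_iff_map_eq_zero _).2 fun t ht => by
    obtain ⟨D, hD⟩ := exists_derivation t.2
    have hDA : D.compAlgebraMap A = 0 :=
      derivation_eq_zero_of_isTranscendenceBasis hi _ fun j =>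
        (congrArg D (aeval_X x (i j))).trans ((hD _).trans (congrFun ht j))
    ext l
    have := congrArg (· ((aeval x).rangeRestrict (X l))) hDA
    simpa [← hD] using this
  have hsurj : Function.Surjective π := fun v => by
    have hind : AlgebraicIndependent k fun j => x (i j) := by
      simpa [Function.comp_def] using hi.1.map' (f := A.val) Subtype.val_injective
    obtain ⟨D, hD⟩ := exists_derivation (k := k) (x := fun j => x (i j)) (t := v)
      (by simp [conormalSpace_eq_bot hind, mem_perp])
    exact ⟨⟨_, derivation_mem_perp_conormalSpace D x⟩, funext hD⟩
  rw [(LinearEquiv.ofBijective π ⟨hinj, hsurj⟩).finrank_eq, Module.finrank_fintype_fun_eq_card]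

theorem trdeg_range_aeval [CharZero k] (x : σ → E) :
    Algebra.trdeg k (aeval x : MvPolynomial σ k →ₐ[k] E).range =
      Module.finrank E (perp (conormalSpace k x)) := by
  let A := (aeval x : MvPolynomial σ k →ₐ[k] E).range
  let xA : σ → A := fun i => (aeval x).rangeRestrict (X i)
  have htop : Algebra.adjoin k (Set.range xA) = ⊤ := by
    have hxA : aeval xA = (aeval x : MvPolynomial σ k →ₐ[k] E).rangeRestrict := by
      ext i
      simp [xA]
    rw [Algebra.adjoin_range_eq_range_aeval, hxA, AlgHom.range_eq_top]
    exact AlgHom.rangeRestrict_surjective _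
  have : Algebra.IsAlgebraic (Algebra.adjoin k (Set.range xA)) A :=
    ⟨fun a => isAlgebraic_algebraMap (⟨a, htop ▸ Algebra.mem_top⟩ : Algebra.adjoin k _)⟩
  obtain ⟨s, hs, hbasis⟩ := exists_isTranscendenceBasis_subset (R := k) (Set.range xA)
  have := ((Set.finite_range xA).subset hs).fintype
  choose i hi using fun j : s => hs j.2
  rw [← card_eq_finrank_perp_conormalSpace (i := i) (by convert hbasis with j; exact hi j),
    ← hbasis.cardinalMk_eq_trdeg, Cardinal.mk_fintype]

variable (k) in
/-- The prime ideal of the polynomials that vanish at a point with coordinates in an extension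
field. -/
abbrev pointIdeal (x : σ → E) : Ideal (MvPolynomial σ k) :=
  RingHom.ker (aeval x : MvPolynomial σ k →ₐ[k] E)

theorem ringKrullDim_quotient_pointIdeal [CharZero k] (x : σ → E) :
    ringKrullDim (MvPolynomial σ k ⧸ pointIdeal k x) =
      Module.finrank E (perp (conormalSpace k x)) := by
  have : Algebra.FiniteType k (aeval x : MvPolynomial σ k →ₐ[k] E).range :=
    .of_surjective (aeval x).rangeRestrict (AlgHom.rangeRestrict_surjective _)
  obtain ⟨d, hdim, htrdeg⟩ :=
    exists_ringKrullDim_eq_and_trdeg_eq k (aeval x : MvPolynomial σ k →ₐ[k] E).range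
  have hd : d = Module.finrank E (perp (conormalSpace k x)) := by
    exact_mod_cast htrdeg.symm.trans (trdeg_range_aeval x)
  rw [← hd, ← hdim]
  exact ringKrullDim_eq_of_ringEquiv
    (Ideal.quotientKerEquivRange (aeval x : MvPolynomial σ k →ₐ[k] E)).toRingEquiv

end ConormalSpace

section Minors

variable {σ τ k E : Type*} [Field k]

theorem exists_det_ne_zero [Finite σ] {r : ℕ} {v : Fin r → σ → k} (hv : LinearIndependent k v) :
    ∃ c : Fin r → σ, (Matrix.of fun i j => v i (c j)).det ≠ 0 := by
  have := Fintype.ofFinite σ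
  have hrank : Module.finrank k (Submodule.span k (Set.range (Matrix.of v).col)) = r := by
    rw [← Matrix.rank_eq_finrank_span_cols, LinearIndependent.rank_matrix (M := Matrix.of v) hv,
      Fintype.card_fin]
  obtain ⟨f, hf, -, hli⟩ := Submodule.exists_fun_fin_finrank_span_eq k (Set.range (Matrix.of v).col)
  choose c hc using fun i => hf (Fin.cast hrank.symm i)
  have hcol : (Matrix.of fun i j => v i (c j)).col = f ∘ Fin.cast hrank.symm := funext hc
  have hunit := hli.comp (Fin.cast hrank.symm) (Fin.cast_injective _)
  rw [← hcol, Matrix.linearIndependent_cols_iff_isUnit, Matrix.isUnit_iff_isUnit_det] at hunit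
  exact ⟨c, hunit.ne_zero⟩

theorem linearIndependent_of_det_ne_zero {r : ℕ} {v : Fin r → σ → k} (c : Fin r → σ)
    (h : (Matrix.of fun i j => v i (c j)).det ≠ 0) : LinearIndependent k v := by
  have hunit : IsUnit (Matrix.of fun i j => v i (c j)) :=
    (Matrix.isUnit_iff_isUnit_det _).2 h.isUnit
  exact .of_comp (LinearMap.funLeft k k c) (Matrix.linearIndependent_rows_iff_isUnit.2 hunit)

variable [Field E] [Algebra k E]

/-- The point `q` is a specialization of the point `z`, which has coordinates in an extension
field, if it satisfies all polynomial equations of `z`: it lies in the variety with generic point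
`z`. -/
def Specializes (z : τ → E) (q : τ → k) : Prop :=
  ∀ h : MvPolynomial τ k, aeval z h = 0 → aeval q h = 0

theorem Specializes.linearIndependent [Finite σ] {z : τ → E} {q : τ → k} (hq : Specializes z q)
    {r : ℕ} {V : Fin r → σ → MvPolynomial τ k}
    (h : LinearIndependent k fun i j => aeval q (V i j)) :
    LinearIndependent E fun i j => aeval z (V i j) := by
  obtain ⟨c, hc⟩ := exists_det_ne_zero h
  refine linearIndependent_of_det_ne_zero c ?_
  have hz := (aeval z).map_det (Matrix.of fun i j => V i (c j))
  have hq' := (aeval q).map_det (Matrix.of fun i j => V i (c j))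
  intro h0
  exact hc (hq'.symm.trans (hq _ (hz.trans h0)))

theorem aeval_eq_zero_iff_forall_specializes [IsAlgClosed k] [Finite τ] (z : τ → E)
    (h : MvPolynomial τ k) :
    aeval z h = 0 ↔ ∀ q : τ → k, Specializes z q → aeval q h = 0 := by
  refine ⟨fun h0 q hq => hq h h0, fun H => ?_⟩
  have hI : (pointIdeal k z).IsPrime := RingHom.ker_isPrime _
  change h ∈ pointIdeal k z
  rw [← IsPrime.vanishingIdeal_zeroLocus (K := k) (pointIdeal k z)]
  exact fun q hq => H q hq

theorem exists_fin_linearIndependent [Finite σ] {ι : Type*} (v : ι → σ → k) (s : Set ι) :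
    ∃ g : Fin (Module.finrank k (Submodule.span k (v '' s))) → ι,
      (∀ i, g i ∈ s) ∧ LinearIndependent k (fun i => v (g i)) ∧
      Submodule.span k (Set.range fun i => v (g i)) = Submodule.span k (v '' s) := by
  obtain ⟨f, hf, hs, hli⟩ := Submodule.exists_fun_fin_finrank_span_eq k (v '' s)
  choose g hg hgf using hf
  obtain rfl : (fun i => v (g i)) = f := funext hgf
  exact ⟨g, hg, hli, hs⟩

end Minors

section ConormalPairs

variable {σ k E : Type*} [Fintype σ] [Field k] [Field E] [Algebra k E]

theorem dotProduct_eq_zero_of_mem_conormalSpace {x v : σ → E}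
    (hx : ∀ h : MvPolynomial σ k, aeval x h = 0 → ∀ d, aeval x (homogeneousComponent d h) = 0)
    (hv : v ∈ conormalSpace k x) : v ⬝ᵥ x = 0 := by
  suffices x ∈ perp (conormalSpace k x) from this v hv
  refine mem_perp_conormalSpace.2 fun h hh => ?_
  have euler (d : ℕ) : grad (homogeneousComponent d h) x ⬝ᵥ x = 0 := by
    have := congrArg (aeval x) (homogeneousComponent_isHomogeneous d h).sum_X_mul_pderiv
    rw [map_nsmul, hx h hh, smul_zero, map_sum] at this
    simpa [grad, dotProduct, mul_comm] using this
  calc grad h x ⬝ᵥ x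
      = ∑ d ∈ Finset.range (h.totalDegree + 1), grad (homogeneousComponent d h) x ⬝ᵥ x := by
        conv_lhs => rw [← sum_homogeneousComponent h]
        simp only [grad, map_sum, dotProduct, Finset.sum_mul]
        exact Finset.sum_comm
    _ = 0 := Finset.sum_eq_zero fun d _ => euler d

theorem mem_conormalSpace_symm [CharZero k] {x y : σ → E}
    (hy : y ∈ conormalSpace k x) (hxy : y ⬝ᵥ x = 0) : x ∈ conormalSpace k y := by
  rw [← perp_perp (conormalSpace k y)]
  -- A tangent vector `t` at `y` is `D y` for a derivation `D`, and `D (y ⬝ᵥ x) = 0` while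
  -- `y ⬝ᵥ D x = 0`.
  intro t ht
  obtain ⟨D, hD⟩ := exists_derivation ht
  have hDx : y ⬝ᵥ (fun i => D (x i)) = 0 := derivation_mem_perp_conormalSpace D x y hy
  have hDyx := congrArg D hxy
  simp only [dotProduct, map_sum, Derivation.leibniz, smul_eq_mul, map_zero, hD,
    Finset.sum_add_distrib] at hDx hDyx
  change t ⬝ᵥ x = 0
  simpa [hDx, dotProduct, mul_comm] using hDyx

/-- The generic point of a conormal variety and its dual: a pair of points with coordinates in a
field that is generated by these coordinates and has the transcendence degree of the affine
bicone over the conormal variety. -/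
structure ConormalPair (k : Type*) [Field k] [Algebra k E] (x y : σ → E) : Prop where
  trdeg_eq : Algebra.trdeg k E = Fintype.card σ
  adjoin_eq_top : IntermediateField.adjoin k (Set.range x ∪ Set.range y) = ⊤
  mem_left : y ∈ conormalSpace k x
  mem_right : x ∈ conormalSpace k y

theorem ConormalPair.symm {x y : σ → E} (h : ConormalPair k x y) : ConormalPair k y x :=
  ⟨h.trdeg_eq, by rw [Set.union_comm]; exact h.adjoin_eq_top, h.mem_right, h.mem_left⟩

/-- The combination of the gradients of `F` at `p` with coefficients `c`. -/
def gradComb {k σ A : Type*} [CommSemiring k] [CommSemiring A] [Algebra k A] {r : ℕ}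
    (F : Fin r → MvPolynomial σ k) (p : σ → A) (c : Fin r → A) : σ → A :=
  ∑ j, c j • grad (F j) p

/-- The pullback of a polynomial in two groups of variables under the parametrization
`(p, c) ↦ (p, ∑ j, c j • ∇(F j) p)` of the conormal variety, as a polynomial in `c` with
coefficients in the polynomials in `p`. -/
def conormalPullback {k σ : Type*} [CommSemiring k] {r : ℕ} (F : Fin r → MvPolynomial σ k) :
    MvPolynomial (σ ⊕ σ) k →ₐ[k] MvPolynomial (Fin r) (MvPolynomial σ k) :=
  aeval (Sum.elim (fun i => C (X i)) (fun i => ∑ j, X j * C (pderiv i (F j))))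

omit [Fintype σ] in
theorem eval₂_conormalPullback {A : Type*} [CommRing A] [Algebra k A] {r : ℕ}
    (F : Fin r → MvPolynomial σ k) (p : σ → A) (c : Fin r → A) (H : MvPolynomial (σ ⊕ σ) k) :
    eval₂ (aeval p : MvPolynomial σ k →ₐ[k] A).toRingHom c (conormalPullback F H) =
      aeval (Sum.elim p (gradComb F p c)) H := by
  have h : ((eval₂Hom (aeval p : MvPolynomial σ k →ₐ[k] A).toRingHom c).comp
      (conormalPullback F).toRingHom) = (aeval (Sum.elim p (gradComb F p c)) :
        MvPolynomial (σ ⊕ σ) k →ₐ[k] A).toRingHom := by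
    apply MvPolynomial.ringHom_ext
    · intro a
      simp [conormalPullback, IsScalarTower.algebraMap_apply k (MvPolynomial σ k)
        (MvPolynomial (Fin r) (MvPolynomial σ k)), algebraMap_eq]
    · rintro (i | i)
      · simp [conormalPullback]
      · simp [conormalPullback, gradComb, grad]
  exact RingHom.congr_fun h H

omit [Fintype σ] in
theorem conormalSpace_eq_span [Finite σ] {x : σ → E} {r : ℕ} {F : Fin r → MvPolynomial σ k}
    (hF : ∀ j, aeval x (F j) = 0) (hli : LinearIndependent E fun j => grad (F j) x)
    (hr : Module.finrank E (conormalSpace k x) = r) :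
    conormalSpace k x = Submodule.span E (Set.range fun j => grad (F j) x) := by
  symm
  apply Submodule.eq_of_le_of_finrank_eq
  · rw [Submodule.span_le]
    rintro _ ⟨j, rfl⟩
    exact Submodule.subset_span ⟨F j, hF j, rfl⟩
  · rw [finrank_span_eq_card hli, hr, Fintype.card_fin]

omit [Fintype σ] in
theorem isAlgebraic_of_adjoin_eq_top {S : Type*} [CommRing S] [IsDomain S] [Algebra k S]
    [Algebra S E] [IsScalarTower k S E] {s : Set E} (hs : IntermediateField.adjoin k s = ⊤)
    (halg : ∀ e ∈ s, IsAlgebraic S e) : Algebra.IsAlgebraic S E := by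
  refine ⟨fun e => ?_⟩
  have he : e ∈ IntermediateField.adjoin k s := hs ▸ IntermediateField.mem_top
  induction he using IntermediateField.adjoin_induction with
  | mem e he => exact halg e he
  | algebraMap c =>
    rw [IsScalarTower.algebraMap_apply k S E]
    exact isAlgebraic_algebraMap _
  | add a b _ _ ha hb => exact ha.add hb
  | inv a _ ha => exact ha.inv
  | mul a b _ _ ha hb => exact ha.mul hb

theorem ConormalPair.trdeg_range_aeval_eq [CharZero k] {x y : σ → E} (hxy : ConormalPair k x y) :
    Algebra.trdeg (aeval x : MvPolynomial σ k →ₐ[k] E).range E =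
      Module.finrank E (conormalSpace k x) := by
  have h := trdeg_add_eq k (aeval x : MvPolynomial σ k →ₐ[k] E).range (A := E)
  rw [hxy.trdeg_eq, trdeg_range_aeval, ← finrank_add_finrank_perp (conormalSpace k x), Nat.cast_add,
    add_comm] at h
  exact Cardinal.eq_of_add_eq_add_right h Cardinal.natCast_lt_aleph0

theorem ConormalPair.algebraicIndependent [CharZero k] {x y : σ → E} (hxy : ConormalPair k x y)
    {r : ℕ} {F : Fin r → MvPolynomial σ k} {μ : Fin r → E} (hμ : gradComb F x μ = y)
    (hr : Module.finrank E (conormalSpace k x) = r) :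
    AlgebraicIndependent (aeval x : MvPolynomial σ k →ₐ[k] E).range μ := by
  let A := (aeval x : MvPolynomial σ k →ₐ[k] E).range
  let S := Algebra.adjoin A (Set.range μ)
  have hA (h : MvPolynomial σ k) : IsAlgebraic S (aeval x h) :=
    isAlgebraic_algebraMap (algebraMap A S ((aeval x).rangeRestrict h))
  have hμS (j : Fin r) : IsAlgebraic S (μ j) :=
    isAlgebraic_algebraMap (⟨μ j, Algebra.subset_adjoin ⟨j, rfl⟩⟩ : S)
  have : Algebra.IsAlgebraic S E := by
    refine isAlgebraic_of_adjoin_eq_top hxy.adjoin_eq_top ?_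
    rintro _ (⟨i, rfl⟩ | ⟨i, rfl⟩)
    · simpa using hA (X i)
    · rw [← hμ, gradComb, Finset.sum_apply]
      exact Finset.sum_induction _ (IsAlgebraic S) (fun _ _ => IsAlgebraic.add)
        isAlgebraic_zero fun j _ => (hμS j).mul (hA (pderiv i (F j)))
  exact (Algebra.IsAlgebraic.isTranscendenceBasis_of_lift_le_trdeg_of_finite A μ
    (by simp [A, hxy.trdeg_range_aeval_eq, hr])).1

theorem ConormalPair.aeval_eq_zero_iff_coeff [CharZero k] {x y : σ → E} (hxy : ConormalPair k x y)
    {r : ℕ} {F : Fin r → MvPolynomial σ k} (hF : ∀ j, aeval x (F j) = 0)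
    (hli : LinearIndependent E fun j => grad (F j) x)
    (hr : Module.finrank E (conormalSpace k x) = r) (H : MvPolynomial (σ ⊕ σ) k) :
    aeval (Sum.elim x y) H = 0 ↔ ∀ m, aeval x (coeff m (conormalPullback F H)) = 0 := by
  obtain ⟨μ, hμ⟩ := (Submodule.mem_span_range_iff_exists_fun E).1
    (conormalSpace_eq_span hF hli hr ▸ hxy.mem_left)
  have hcomp : (algebraMap (aeval x : MvPolynomial σ k →ₐ[k] E).range E).comp
      (aeval x : MvPolynomial σ k →ₐ[k] E).rangeRestrict.toRingHom =
        (aeval x : MvPolynomial σ k →ₐ[k] E).toRingHom := rfl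
  have hH : aeval (Sum.elim x y) H = aeval μ
      (map (aeval x : MvPolynomial σ k →ₐ[k] E).rangeRestrict.toRingHom
        (conormalPullback F H)) := by
    rw [aeval_def μ, eval₂_map, hcomp, eval₂_conormalPullback, gradComb, hμ]
  rw [hH, map_eq_zero_iff _ (hxy.algebraicIndependent hμ hr), MvPolynomial.ext_iff]
  simp [coeff_map, Subtype.ext_iff]

theorem ConormalPair.aeval_eq_zero_iff [CharZero k] [IsAlgClosed k] {x y : σ → E}
    (hxy : ConormalPair k x y) {r : ℕ} {F : Fin r → MvPolynomial σ k}
    (hF : ∀ j, aeval x (F j) = 0) (hli : LinearIndependent E fun j => grad (F j) x)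
    (hr : Module.finrank E (conormalSpace k x) = r) (H : MvPolynomial (σ ⊕ σ) k) :
    aeval (Sum.elim x y) H = 0 ↔
      ∀ p : σ → k, Specializes x p → ∀ c, aeval (Sum.elim p (gradComb F p c)) H = 0 := by
  have hcoeff (p : σ → k) : (∀ m, aeval p (coeff m (conormalPullback F H)) = 0) ↔
      ∀ c, aeval (Sum.elim p (gradComb F p c)) H = 0 := by
    rw [forall_congr' fun m => by rw [← AlgHom.coe_toRingHom, ← coeff_map, ← coeff_zero m],
      ← MvPolynomial.ext_iff, MvPolynomial.funext_iff]
    simp only [← eval₂_conormalPullback, eval₂_eq_eval_map, map_zero]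
    rfl
  rw [hxy.aeval_eq_zero_iff_coeff hF hli hr]
  simp only [fun m => aeval_eq_zero_iff_forall_specializes x (coeff m (conormalPullback F H)),
    ← hcoeff]
  exact ⟨fun h p hp m => h m p hp, fun h m p hp => h p hp m⟩

end ConormalPairs

section Construction

universe u v w

variable {σ : Type u} {k : Type v} {K : Type w} [Fintype σ] [Field k] [Field K] [Algebra k K]

theorem trdeg_of_adjoin_eq_top [CharZero k] {x : σ → K}
    (hx : IntermediateField.adjoin k (Set.range x) = ⊤) :
    Algebra.trdeg k K = Module.finrank K (perp (conormalSpace k x)) := by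
  let A := (aeval x : MvPolynomial σ k →ₐ[k] K).range
  have : Algebra.IsAlgebraic A K := isAlgebraic_of_adjoin_eq_top hx <| by
    rintro _ ⟨i, rfl⟩
    exact isAlgebraic_algebraMap (⟨x i, X i, aeval_X x i⟩ : A)
  rw [← trdeg_range_aeval, ← trdeg_add_eq k A (A := K), trdeg_eq_zero (R := A), add_zero]

omit [Fintype σ] in
theorem algebraMap_comp_mem_conormalSpace {E : Type*} [Field E] [Algebra k E] [Algebra K E]
    [IsScalarTower k K E] {x v : σ → K} (hv : v ∈ conormalSpace k x) :
    algebraMap K E ∘ v ∈ conormalSpace k (algebraMap K E ∘ x) := by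
  induction hv using Submodule.span_induction with
  | mem v hv =>
    obtain ⟨h, hh, rfl⟩ := hv
    refine Submodule.subset_span ⟨h, ?_, ?_⟩
    · rw [aeval_algebraMap_apply, hh, map_zero]
    · ext i
      exact aeval_algebraMap_apply E x (pderiv i h)
  | zero => convert (conormalSpace k (algebraMap K E ∘ x)).zero_mem; ext; simp
  | add v w _ _ hv hw => convert add_mem hv hw; ext; simp
  | smul c v _ hv => convert Submodule.smul_mem _ (algebraMap K E c) hv; ext; simp

omit [Fintype σ] in
theorem algebraMap_mem_of_adjoin_eq_top {E : Type*} [Field E] [Algebra k E] [Algebra K E]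
    [IsScalarTower k K E] {x : σ → K} (hx : IntermediateField.adjoin k (Set.range x) = ⊤)
    {L : IntermediateField k E} (hL : ∀ i, algebraMap K E (x i) ∈ L) (a : K) :
    algebraMap K E a ∈ L := by
  have hle : IntermediateField.adjoin k (Set.range x) ≤ L.comap (IsScalarTower.toAlgHom k K E) :=
    IntermediateField.adjoin_le_iff.2 (by rintro _ ⟨i, rfl⟩; exact hL i)
  exact hle (hx ▸ IntermediateField.mem_top)

theorem exists_sum_mul_sum_basis_eq {E κ : Type*} [CommRing E] [Algebra K E] [Fintype κ]
    {W : Submodule K (σ → K)} (b : Module.Basis κ K W) (μ : κ → E) (j : κ) :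
    ∃ a : σ → K, ∑ i, algebraMap K E (a i) * ∑ l, μ l * algebraMap K E ((b l : σ → K) i) = μ j := by
  classical
  obtain ⟨φ, hφ⟩ := LinearMap.exists_extend (b.coord j)
  have hφb (l : κ) : ∑ i, (b l : σ → K) i * φ (Pi.single i 1) = if l = j then 1 else 0 := by
    have := LinearMap.congr_fun hφ (b l)
    rw [LinearMap.comp_apply, Submodule.subtype_apply, φ.pi_apply_eq_sum_univ] at this
    have hsingle (i : σ) : (fun j => if i = j then 1 else 0) = Pi.single i (1 : K) := by
      ext j
      simp [Pi.single_apply, eq_comm]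
    simpa [hsingle, Finsupp.single_apply] using this
  refine ⟨fun i => φ (Pi.single i 1), ?_⟩
  calc ∑ i, algebraMap K E (φ (Pi.single i 1)) * ∑ l, μ l * algebraMap K E ((b l : σ → K) i)
      = ∑ l, μ l * algebraMap K E (∑ i, (b l : σ → K) i * φ (Pi.single i 1)) := by
        simp only [map_sum, map_mul, Finset.mul_sum]
        rw [Finset.sum_comm]
        exact Finset.sum_congr rfl fun _ _ => Finset.sum_congr rfl fun _ _ => by ring
    _ = μ j := by simp [hφb]

omit [Fintype σ] in
theorem adjoin_eq_top_of_basis {E κ : Type*} [Finite σ] [Field E] [Fintype κ] [Algebra k E]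
    [Algebra K E] [IsScalarTower k K E] [Algebra (MvPolynomial κ K) E]
    [IsScalarTower K (MvPolynomial κ K) E] [IsFractionRing (MvPolynomial κ K) E] {x₀ : σ → K}
    (hx₀ : IntermediateField.adjoin k (Set.range x₀) = ⊤) {W : Submodule K (σ → K)}
    (b : Module.Basis κ K W) :
    IntermediateField.adjoin k (Set.range (algebraMap K E ∘ x₀) ∪ Set.range fun i =>
      ∑ l, algebraMap (MvPolynomial κ K) E (X l) * algebraMap K E ((b l : σ → K) i)) = ⊤ := by
  have := Fintype.ofFinite σ
  set L := IntermediateField.adjoin k (_ : Set E)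
  have hK : ∀ a, algebraMap K E a ∈ L := algebraMap_mem_of_adjoin_eq_top hx₀ fun i =>
    IntermediateField.subset_adjoin k _ (.inl ⟨i, rfl⟩)
  have hX (j : κ) : algebraMap (MvPolynomial κ K) E (X j) ∈ L := by
    obtain ⟨a, ha⟩ := exists_sum_mul_sum_basis_eq b
      (fun l => algebraMap (MvPolynomial κ K) E (X l)) j
    rw [← ha]
    exact sum_mem fun i _ => mul_mem (hK _) (IntermediateField.subset_adjoin k _ (.inr ⟨i, rfl⟩))
  have hM (m : MvPolynomial κ K) : algebraMap (MvPolynomial κ K) E m ∈ L := by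
    induction m using MvPolynomial.induction_on with
    | C a => simpa [IsScalarTower.algebraMap_apply K (MvPolynomial κ K) E, algebraMap_eq] using hK a
    | add p q hp hq => exact map_add (algebraMap _ E) p q ▸ add_mem hp hq
    | mul_X p j hp => exact map_mul (algebraMap _ E) p (X j) ▸ mul_mem hp (hX j)
  rw [_root_.eq_top_iff]
  intro e _
  obtain ⟨p, q, -, rfl⟩ := IsFractionRing.div_surjective (A := MvPolynomial κ K) e
  exact div_mem (hM p) (hM q)

/-- The field `E` is `K(μ)` with independent variables `μ`, and `y` is the combination with
coefficients `μ` of a basis of the conormal space at `x₀`. -/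
theorem exists_conormalPair [CharZero k] {x₀ : σ → K}
    (hx₀ : IntermediateField.adjoin k (Set.range x₀) = ⊤)
    (hhom : ∀ h : MvPolynomial σ k, aeval x₀ h = 0 → ∀ d, aeval x₀ (homogeneousComponent d h) = 0) :
    ∃ (E : Type w) (_ : Field E) (_ : Algebra k E) (x y : σ → E),
      pointIdeal k x = pointIdeal k x₀ ∧ ConormalPair k x y := by
  let b := Module.finBasis K (conormalSpace k x₀)
  let M := MvPolynomial (Fin (Module.finrank K (conormalSpace k x₀))) K
  let E := FractionRing M
  let x : σ → E := algebraMap K E ∘ x₀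
  let y : σ → E := fun i => ∑ l, algebraMap M E (X l) * algebraMap K E ((b l : σ → K) i)
  have hx (h : MvPolynomial σ k) : aeval x h = 0 ↔ aeval x₀ h = 0 := by
    simp only [x, aeval_algebraMap_apply, map_eq_zero]
  have hy : y ∈ conormalSpace k x := by
    have hy_eq : y = ∑ l, algebraMap M E (X l) • (algebraMap K E ∘ (b l : σ → K)) := by
      ext i
      rw [Finset.sum_apply]
      rfl
    rw [hy_eq]
    exact Submodule.sum_mem _ fun l _ => Submodule.smul_mem _ _
      (algebraMap_comp_mem_conormalSpace (b l).2)
  have htrdeg : Algebra.trdeg k E = Fintype.card σ := by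
    have : Algebra.IsAlgebraic M E := IsLocalization.isAlgebraic E (nonZeroDivisors M)
    rw [← trdeg_add_eq k K (A := E), ← trdeg_add_eq K M (A := E), trdeg_of_adjoin_eq_top hx₀,
      trdeg_eq_zero (R := M) (A := E), MvPolynomial.trdeg_of_isDomain,
      ← finrank_add_finrank_perp (conormalSpace k x₀)]
    simp [add_comm]
  refine ⟨E, inferInstance, inferInstance, x, y, Ideal.ext hx, htrdeg, adjoin_eq_top_of_basis hx₀ b,
    hy, mem_conormalSpace_symm hy (dotProduct_eq_zero_of_mem_conormalSpace ?_ hy)⟩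
  exact fun h hh d => (hx _).2 (hhom h ((hx h).1 hh) d)

omit [Fintype σ] in
theorem exists_pointIdeal_eq (P : Ideal (MvPolynomial σ k)) [P.IsPrime] :
    ∃ (K : Type max u v) (_ : Field K) (_ : Algebra k K) (x : σ → K),
      pointIdeal k x = P ∧ IntermediateField.adjoin k (Set.range x) = ⊤ := by
  let B := MvPolynomial σ k ⧸ P
  let K := FractionRing B
  let x : σ → K := fun i => algebraMap B K (Ideal.Quotient.mk P (X i))
  have hx (h : MvPolynomial σ k) : aeval x h = algebraMap B K (Ideal.Quotient.mk P h) := by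
    have : (aeval x : MvPolynomial σ k →ₐ[k] K) =
        (IsScalarTower.toAlgHom k B K).comp (Ideal.Quotient.mkₐ k P) := by
      ext i
      exact aeval_X x i
    exact DFunLike.congr_fun this h
  have hinj : Function.Injective (algebraMap B K) := IsFractionRing.injective B K
  refine ⟨K, inferInstance, inferInstance, x, Ideal.ext fun h => ?_, ?_⟩
  · rw [RingHom.mem_ker, hx, map_eq_zero_iff _ hinj, Ideal.Quotient.eq_zero_iff_mem]
  · have hmem (h : MvPolynomial σ k) :
        aeval x h ∈ IntermediateField.adjoin k (Set.range x) := by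
      refine IntermediateField.algebra_adjoin_le_adjoin k _ ?_
      rw [Algebra.adjoin_range_eq_range_aeval]
      exact ⟨h, rfl⟩
    rw [_root_.eq_top_iff]
    intro e _
    obtain ⟨p, q, -, rfl⟩ := IsFractionRing.div_surjective (A := B) e
    obtain ⟨p, rfl⟩ := Ideal.Quotient.mk_surjective p
    obtain ⟨q, rfl⟩ := Ideal.Quotient.mk_surjective q
    rw [← hx, ← hx]
    exact div_mem (hmem p) (hmem q)

end Construction

section Homogeneous

variable {σ k A : Type*} [CommSemiring k] [CommSemiring A] [Algebra k A]

theorem aeval_smul_of_isHomogeneous {f : MvPolynomial σ k} {d : ℕ}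
    (hf : f.IsHomogeneous d) (t : k) (z : σ → A) : aeval (t • z) f = t ^ d • aeval z f := by
  rw [aeval_def, aeval_def, eval₂_eq, eval₂_eq, Finset.smul_sum]
  refine Finset.sum_congr rfl fun m hm => ?_
  have hd : ∑ i ∈ m.support, m i = d := by
    simpa [Finsupp.weight_apply, Finsupp.sum] using hf (mem_support_iff.1 hm)
  simp only [Pi.smul_apply, Algebra.smul_def, mul_pow, Finset.prod_mul_distrib,
    Finset.prod_pow_eq_pow_sum, map_pow, hd]
  ring

theorem grad_smul_of_isHomogeneous {f : MvPolynomial σ k} {d : ℕ}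
    (hf : f.IsHomogeneous d) (t : k) (z : σ → A) : grad f (t • z) = t ^ (d - 1) • grad f z := by
  ext i
  exact aeval_smul_of_isHomogeneous hf.pderiv t z

theorem aeval_homogeneousComponent_eq_zero {k E : Type*} [Field k] [Infinite k]
    [Field E] [Algebra k E] {z : σ → E} {f : MvPolynomial σ k}
    (h : ∀ t : k, t ≠ 0 → aeval (t • z) f = 0) (d : ℕ) :
    aeval z (homogeneousComponent d f) = 0 := by
  let p : Polynomial E := ∑ e ∈ Finset.range (f.totalDegree + 1),
    Polynomial.monomial e (aeval z (homogeneousComponent e f))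
  have hroot : ∀ t : k, t ≠ 0 → p.IsRoot (algebraMap k E t) := fun t ht => by
    rw [Polynomial.IsRoot, ← h t ht, ← sum_homogeneousComponent f, map_sum,
      Polynomial.eval_finsetSum]
    refine Finset.sum_congr rfl fun e _ => ?_
    rw [aeval_smul_of_isHomogeneous (homogeneousComponent_isHomogeneous e _),
      Polynomial.eval_monomial, Algebra.smul_def, map_pow, mul_comm]
  have hp : p = 0 := p.eq_zero_of_infinite_isRoot <|
    ((Set.finite_singleton (0 : k)).infinite_compl.image
      (algebraMap k E).injective.injOn).mono (by rintro _ ⟨t, ht, rfl⟩; exact hroot t ht)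
  by_cases hd : d < f.totalDegree + 1
  · simpa [p, Polynomial.finsetSum_coeff, Polynomial.coeff_monomial, Nat.lt_add_one_iff.1 hd]
      using congrArg (Polynomial.coeff · d) hp
  · rw [homogeneousComponent_eq_zero _ _ (by omega), map_zero]

end Homogeneous

section GenericPoint

variable {σ k E : Type*} [Field k] [Field E] [Algebra k E]

theorem ringKrullDim_quotient_of_radical_eq [Fintype σ] [CharZero k] {I : Ideal (MvPolynomial σ k)}
    {x : σ → E} (hI : I.radical = pointIdeal k x) :
    ringKrullDim (MvPolynomial σ k ⧸ I) = Module.finrank E (perp (conormalSpace k x)) := by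
  rw [← ringKrullDim_quotient_pointIdeal, ringKrullDim_quotient, ringKrullDim_quotient, ← hI,
    PrimeSpectrum.zeroLocus_radical]

theorem mem_radical_span_iff [Finite σ] [IsAlgClosed k] {S : Set (MvPolynomial σ k)}
    {f : MvPolynomial σ k} :
    f ∈ (Ideal.span S).radical ↔ ∀ p : σ → k, (∀ g ∈ S, aeval p g = 0) → aeval p f = 0 := by
  rw [← vanishingIdeal_zeroLocus_eq_radical (K := k), mem_vanishingIdeal_iff,
    MvPolynomial.zeroLocus_span]
  rfl

/-- The span of the gradients at a point of a set of polynomials. -/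
def gradSpan {A : Type*} [CommSemiring A] [Algebra k A] (S : Set (MvPolynomial σ k)) (p : σ → A) :
    Submodule A (σ → A) :=
  Submodule.span A ((fun f => grad f p) '' S)

/-- The point `x` with coordinates in an extension field is a generic point of the affine cone over
the variety defined by the homogeneous polynomials `S`, and the rank of their Jacobian matrix at
`x` is the codimension, that is, `S` defines a generically reduced scheme. The zero locus of `S` is
described by its points over the base field. -/
structure IsGenericPoint (S : Set (MvPolynomial σ k)) (x : σ → E) : Prop where
  homog : ∀ f ∈ S, ∃ d : ℕ, f.IsHomogeneous d
  forall_aeval_eq_zero_iff : ∀ p : σ → k, (∀ f ∈ S, aeval p f = 0) ↔ Specializes x p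
  gradSpan_eq : gradSpan S x = conormalSpace k x
  ne_zero : x ≠ 0

namespace IsGenericPoint

variable {S : Set (MvPolynomial σ k)} {x : σ → E}

theorem aeval_eq_zero [Finite σ] [IsAlgClosed k] (hx : IsGenericPoint S x) {f : MvPolynomial σ k}
    (hf : f ∈ S) : aeval x f = 0 :=
  (aeval_eq_zero_iff_forall_specializes x f).2 fun p hp =>
    (hx.forall_aeval_eq_zero_iff p).2 hp f hf

theorem radical_span [Finite σ] [IsAlgClosed k] (hx : IsGenericPoint S x) :
    (Ideal.span S).radical = pointIdeal k x := by
  ext f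
  rw [mem_radical_span_iff, RingHom.mem_ker, aeval_eq_zero_iff_forall_specializes]
  exact forall_congr' fun p => imp_congr_left (hx.forall_aeval_eq_zero_iff p)

theorem specializes_smul (hx : IsGenericPoint S x) {p : σ → k} (hp : Specializes x p) (t : k) :
    Specializes x (t • p) := by
  rw [← hx.forall_aeval_eq_zero_iff] at hp ⊢
  intro f hf
  obtain ⟨d, hd⟩ := hx.homog f hf
  rw [aeval_smul_of_isHomogeneous hd, hp f hf, smul_zero]

theorem exists_fin_linearIndependent [Finite σ] (hx : IsGenericPoint S x) :
    ∃ F : Fin (Module.finrank E (conormalSpace k x)) → MvPolynomial σ k, (∀ j, F j ∈ S) ∧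
      LinearIndependent E fun j => grad (F j) x := by
  obtain ⟨F, hF, hli, -⟩ := MLDual.exists_fin_linearIndependent (fun f => grad f x) S
  rw [← hx.gradSpan_eq]
  exact ⟨F, hF, hli⟩

end IsGenericPoint

end GenericPoint

section GradSpan

variable {σ k E : Type*} [Field k] [Field E] [Algebra k E] {S : Set (MvPolynomial σ k)} {x : σ → E}

theorem gradSpan_smul (hS : ∀ f ∈ S, ∃ d : ℕ, f.IsHomogeneous d) (p : σ → k) {t : k} (ht : t ≠ 0) :
    gradSpan S (t • p) = gradSpan S p := by
  have hle (q : σ → k) (s : k) : gradSpan S (s • q) ≤ gradSpan S q := by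
    refine Submodule.span_le.2 ?_
    rintro _ ⟨f, hf, rfl⟩
    obtain ⟨d, hd⟩ := hS f hf
    change grad f (s • q) ∈ gradSpan S q
    rw [grad_smul_of_isHomogeneous hd]
    exact Submodule.smul_mem _ _ (Submodule.subset_span ⟨f, hf, rfl⟩)
  refine le_antisymm (hle p t) ?_
  simpa [smul_smul, ht] using hle (t • p) t⁻¹

theorem le_finrank_gradSpan [Finite σ] {r : ℕ} {F : Fin r → MvPolynomial σ k} (hF : ∀ j, F j ∈ S)
    (hli : LinearIndependent E fun j => grad (F j) x) : r ≤ Module.finrank E (gradSpan S x) := by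
  have hle : Submodule.span E (Set.range fun j => grad (F j) x) ≤ gradSpan S x :=
    Submodule.span_mono (by rintro _ ⟨j, rfl⟩; exact ⟨F j, hF j, rfl⟩)
  simpa [finrank_span_eq_card hli] using Submodule.finrank_mono hle

theorem finrank_gradSpan_le_of_specializes [Finite σ] {p : σ → k} (hp : Specializes x p) :
    Module.finrank k (gradSpan S p) ≤ Module.finrank E (gradSpan S x) := by
  obtain ⟨F, hF, hli, -⟩ := exists_fin_linearIndependent (fun f => grad f p) S
  exact le_finrank_gradSpan hF (hp.linearIndependent (V := fun j i => pderiv i (F j)) hli)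

theorem IsGenericPoint.exists_forall_finrank_gradSpan_eq [Finite σ] (hx : IsGenericPoint S x) :
    ∃ δ : MvPolynomial σ k, aeval x δ ≠ 0 ∧ ∀ p : σ → k, Specializes x p → aeval p δ ≠ 0 →
      Module.finrank k (gradSpan S p) = Module.finrank E (conormalSpace k x) := by
  obtain ⟨F, hF, hli⟩ := hx.exists_fin_linearIndependent
  obtain ⟨c, hc⟩ := exists_det_ne_zero hli
  let M := Matrix.of fun i j => pderiv (c j) (F i)
  refine ⟨M.det, ((aeval x).map_det M).trans_ne hc, fun p hp hδ => le_antisymm ?_ ?_⟩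
  · exact hx.gradSpan_eq ▸ finrank_gradSpan_le_of_specializes hp
  · exact le_finrank_gradSpan hF
      (linearIndependent_of_det_ne_zero c (((aeval p).map_det M).symm.trans_ne hδ))

end GradSpan

section ConormalFibre

variable {σ k E : Type*} [Field k] [Field E] [Algebra k E] {x y : σ → E}

theorem specializes_sumElim_swap {p b : σ → k} (h : Specializes (Sum.elim x y) (Sum.elim p b)) :
    Specializes (Sum.elim y x) (Sum.elim b p) := fun H hH => by
  have := h (rename Sum.swap H)
  rw [aeval_rename, aeval_rename, Sum.elim_swap, Sum.elim_swap] at this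
  exact this hH

theorem Specializes.fst {p b : σ → k} (h : Specializes (Sum.elim x y) (Sum.elim p b)) :
    Specializes x p := fun f hf => by
  have := h (rename Sum.inl f)
  rw [aeval_rename, aeval_rename, Sum.elim_comp_inl, Sum.elim_comp_inl] at this
  exact this hf

theorem Specializes.snd {p b : σ → k} (h : Specializes (Sum.elim x y) (Sum.elim p b)) :
    Specializes y b :=
  (specializes_sumElim_swap h).fst

theorem aeval_finCons_pderiv {A : Type*} [CommRing A] [Algebra k A] {r : ℕ}
    (F : Fin r → MvPolynomial σ k) (z w : σ → A) :
    (fun j i => aeval (Sum.elim z w) ((Fin.cons (fun i => X (Sum.inr i))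
      (fun j i => rename Sum.inl (pderiv i (F j))) :
        Fin (r + 1) → σ → MvPolynomial (σ ⊕ σ) k) j i)) =
      (Fin.cons w fun j => grad (F j) z : Fin (r + 1) → σ → A) := by
  funext j i
  induction j using Fin.cases with
  | zero => simp
  | succ j => simp [aeval_rename, Function.comp_def, grad]

theorem Specializes.mem_span_grad [Finite σ] {r : ℕ} {F : Fin r → MvPolynomial σ k} {p b : σ → k}
    (h : Specializes (Sum.elim x y) (Sum.elim p b))
    (hli : LinearIndependent k fun j => grad (F j) p)
    (hy : y ∈ Submodule.span E (Set.range fun j => grad (F j) x)) :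
    b ∈ Submodule.span k (Set.range fun j => grad (F j) p) := by
  by_contra hb
  have hcons : LinearIndependent k (Fin.cons b fun j => grad (F j) p : Fin (r + 1) → σ → k) :=
    linearIndependent_finCons.2 ⟨hli, hb⟩
  rw [← aeval_finCons_pderiv] at hcons
  have hconsE := h.linearIndependent hcons
  rw [aeval_finCons_pderiv, linearIndependent_finCons] at hconsE
  exact hconsE.2 hy

/-- The substitution `(x, y) ↦ (s • x, t • y)` in polynomials in two groups of variables. -/
def scaleVars (s t : k) : MvPolynomial (σ ⊕ σ) k →ₐ[k] MvPolynomial (σ ⊕ σ) k :=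
  aeval (Sum.elim (fun i => s • X (Sum.inl i)) (fun i => t • X (Sum.inr i)))

theorem aeval_scaleVars {A : Type*} [CommRing A] [Algebra k A] (s t : k) (z w : σ → A)
    (H : MvPolynomial (σ ⊕ σ) k) :
    aeval (Sum.elim z w) (scaleVars s t H) = aeval (Sum.elim (s • z) (t • w)) H := by
  rw [scaleVars, ← AlgHom.comp_apply, comp_aeval]
  congr 2
  ext (i | i) <;> simp

variable [Fintype σ] [CharZero k] [IsAlgClosed k] {S : Set (MvPolynomial σ k)}

theorem IsGenericPoint.specializes_iff_mem_gradSpan (hx : IsGenericPoint S x)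
    (hxy : ConormalPair k x y) {p : σ → k} (hp : Specializes x p)
    (hreg : Module.finrank k (gradSpan S p) = Module.finrank E (conormalSpace k x)) (b : σ → k) :
    Specializes (Sum.elim x y) (Sum.elim p b) ↔ b ∈ gradSpan S p := by
  obtain ⟨F, hFS, hli, hspan⟩ := MLDual.exists_fin_linearIndependent (fun f => grad f p) S
  have hliE := hp.linearIndependent (V := fun j i => pderiv i (F j)) hli
  have hF := fun j => hx.aeval_eq_zero (hFS j)
  rw [gradSpan, ← hspan]
  refine ⟨fun h => h.mem_span_grad hli ?_, fun hb H hH => ?_⟩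
  · exact conormalSpace_eq_span hF hliE hreg.symm ▸ hxy.mem_left
  · obtain ⟨c, rfl⟩ := (Submodule.mem_span_range_iff_exists_fun k).1 hb
    exact (hxy.aeval_eq_zero_iff hF hliE hreg.symm H).1 hH p hp c

theorem IsGenericPoint.aeval_smul_smul_eq_zero (hx : IsGenericPoint S x)
    (hxy : ConormalPair k x y) {H : MvPolynomial (σ ⊕ σ) k} (hH : aeval (Sum.elim x y) H = 0)
    {s : k} (t : k) (hs : s ≠ 0) : aeval (Sum.elim (s • x) (t • y)) H = 0 := by
  obtain ⟨F, hFS, hli⟩ := hx.exists_fin_linearIndependent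
  have hF := fun j => hx.aeval_eq_zero (hFS j)
  choose e he using fun j => hx.homog (F j) (hFS j)
  rw [← aeval_scaleVars, hxy.aeval_eq_zero_iff hF hli rfl]
  intro p hp c
  have hc : t • gradComb F p c =
      gradComb F (s • p) (fun j => t * (s ^ (e j - 1))⁻¹ * c j) := by
    simp only [gradComb, Finset.smul_sum, grad_smul_of_isHomogeneous (he _), smul_smul]
    refine Finset.sum_congr rfl fun j _ => ?_
    have : s ^ (e j - 1) ≠ 0 := pow_ne_zero _ hs
    congr 1
    field_simp
  rw [aeval_scaleVars, hc]
  exact (hxy.aeval_eq_zero_iff hF hli rfl H).1 hH _ (hx.specializes_smul hp s) _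

theorem IsGenericPoint.specializes_smul_smul (hx : IsGenericPoint S x) (hxy : ConormalPair k x y)
    {p b : σ → k} (h : Specializes (Sum.elim x y) (Sum.elim p b)) {s : k} (t : k) (hs : s ≠ 0) :
    Specializes (Sum.elim x y) (Sum.elim (s • p) (t • b)) := fun H hH => by
  rw [← aeval_scaleVars]
  exact h _ ((aeval_scaleVars s t x y H).trans (hx.aeval_smul_smul_eq_zero hxy hH t hs))

end ConormalFibre

section RegularPoint

variable {σ : Type} [Fintype σ] {E : Type*} [Field E] [Algebra ℂ E]
  {S : Set (MvPolynomial σ ℂ)} {x y : σ → E}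

theorem tangentSpace_eq_perp (S : Set (MvPolynomial σ ℂ)) (p : PSpace σ) :
    tangentSpace S p = perp (gradSpan S p.rep) := by
  ext t
  rw [gradSpan, mem_perp_span, Set.forall_mem_image]
  rfl

theorem perpTangent_iff {p : PSpace σ} {v : σ → ℂ} :
    PerpTangent S p v ↔ v ∈ gradSpan S p.rep := by
  rw [PerpTangent, tangentSpace_eq_perp, ← perp_perp (gradSpan S p.rep), perp_perp, mem_perp]
  exact forall₂_congr fun t _ => by rw [dotProduct_comm]; rfl

theorem isRegularPoint_iff_of_radical_span_eq (hS : (Ideal.span S).radical = pointIdeal ℂ x)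
    {p : PSpace σ} :
    IsRegularPoint S p ↔ p ∈ zeroLocus S ∧
      Module.finrank ℂ (gradSpan S p.rep) = Module.finrank E (conormalSpace ℂ x) := by
  have hp := finrank_add_finrank_perp (gradSpan S p.rep)
  have hx := finrank_add_finrank_perp (conormalSpace ℂ x)
  rw [IsRegularPoint, ringKrullDim_quotient_of_radical_eq hS, tangentSpace_eq_perp]
  refine and_congr Iff.rfl ⟨fun h => ?_, fun h => ?_⟩
  · have : Module.finrank ℂ (perp (gradSpan S p.rep)) =
        Module.finrank E (perp (conormalSpace ℂ x)) := mod_cast h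
    omega
  · congr 2
    omega

omit [Fintype σ] in
theorem exists_rep_mk_eq (v : σ → ℂ) (hv : v ≠ 0) :
    ∃ a : ℂ, a ≠ 0 ∧ (Projectivization.mk ℂ v hv).rep = a • v :=
  let ⟨a, ha⟩ := Projectivization.exists_smul_eq_mk_rep ℂ v hv
  ⟨a, a.ne_zero, ha.symm⟩

namespace IsGenericPoint

theorem isRegularPoint_iff (hx : IsGenericPoint S x) {p : PSpace σ} :
    IsRegularPoint S p ↔ Specializes x p.rep ∧
      Module.finrank ℂ (gradSpan S p.rep) = Module.finrank E (conormalSpace ℂ x) := by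
  rw [isRegularPoint_iff_of_radical_span_eq hx.radical_span, ← hx.forall_aeval_eq_zero_iff]
  rfl

omit [Fintype σ] in
theorem specializes_smul_iff (hx : IsGenericPoint S x) {p : σ → ℂ} {t : ℂ} (ht : t ≠ 0) :
    Specializes x (t • p) ↔ Specializes x p :=
  ⟨fun h => by simpa [smul_smul, ht] using hx.specializes_smul h t⁻¹,
    fun h => hx.specializes_smul h t⟩

theorem isRegularPoint_mk_iff (hx : IsGenericPoint S x) {v : σ → ℂ} (hv : v ≠ 0) :
    IsRegularPoint S (Projectivization.mk ℂ v hv) ↔ Specializes x v ∧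
      Module.finrank ℂ (gradSpan S v) = Module.finrank E (conormalSpace ℂ x) := by
  obtain ⟨a, ha, hrep⟩ := exists_rep_mk_eq v hv
  rw [hx.isRegularPoint_iff, hrep, gradSpan_smul hx.homog _ ha, hx.specializes_smul_iff ha]

end IsGenericPoint

end RegularPoint

section DualVariety

variable {σ : Type} [Fintype σ] {E : Type*} [Field E] [Algebra ℂ E]
  {S : Set (MvPolynomial σ ℂ)} {x y : σ → E}

omit [Fintype σ] in
theorem aeval_rename_inl_mul_rename_inr {A : Type*} [CommSemiring A] [Algebra ℂ A] (z w : σ → A)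
    (f g : MvPolynomial σ ℂ) :
    aeval (Sum.elim z w) (rename Sum.inl f * rename Sum.inr g) = aeval z f * aeval w g := by
  rw [map_mul, aeval_rename, aeval_rename, Sum.elim_comp_inl, Sum.elim_comp_inr]

omit [Fintype σ] in
theorem isBihomog_rename_inr {f : MvPolynomial σ ℂ} (hf : IsHomog f) :
    IsBihomog (rename Sum.inr f : MvPolynomial (σ ⊕ σ) ℂ) := by
  obtain ⟨d, hd⟩ := hf
  refine ⟨0, d, fun m hm => ?_⟩
  obtain ⟨u, rfl, hu⟩ := coeff_rename_ne_zero _ _ _ hm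
  have h := hd hu
  rw [Finsupp.weight_apply, Finsupp.sum] at h
  rw [Finsupp.weight_apply, Finsupp.sum_mapDomain_index (by simp) (by simp [add_smul]), Finsupp.sum]
  ext
  · simp [Prod.fst_sum]
  · simpa [Prod.snd_sum] using h

theorem exists_isRegularPoint_of_dualVariety_nonempty (h : (dualVariety S).Nonempty) :
    ∃ p, IsRegularPoint S p := by
  obtain ⟨-, z, hz, rfl⟩ := h
  by_contra! hreg
  simpa using hz 1 ⟨0, 0, isWeightedHomogeneous_one _ _⟩ fun q hq => absurd hq.1 (hreg q.1)

theorem mk_mem_dualVariety (hS : ∀ f ∈ S, IsHomog f) {v : σ → ℂ} (hv : v ≠ 0)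
    (hreg : IsRegularPoint S (Projectivization.mk ℂ v hv)) {b : σ → ℂ} (hb : b ≠ 0)
    (hbv : b ∈ gradSpan S v) : Projectivization.mk ℂ b hb ∈ dualVariety S := by
  refine ⟨(Projectivization.mk ℂ v hv, Projectivization.mk ℂ b hb),
    fun F _ hF => hF _ ⟨hreg, perpTangent_iff.2 ?_⟩, rfl⟩
  obtain ⟨s, hs, hsv⟩ := exists_rep_mk_eq v hv
  obtain ⟨t, -, htb⟩ := exists_rep_mk_eq b hb
  rw [hsv, htb, gradSpan_smul hS _ hs]
  exact Submodule.smul_mem _ t hbv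

namespace IsGenericPoint

theorem specializes_rep_of_mem_dualVariety (hx : IsGenericPoint S x) (hxy : ConormalPair ℂ x y)
    {b : PSpace σ} (hb : b ∈ dualVariety S) {f : MvPolynomial σ ℂ} (hf : IsHomog f)
    (hfy : aeval y f = 0) : eval b.rep f = 0 := by
  obtain ⟨z, hz, rfl⟩ := hb
  have hvan := hz (rename Sum.inr f) (isBihomog_rename_inr hf) <| by
    rintro ⟨p, q⟩ ⟨hp, hq⟩
    obtain ⟨hs, hr⟩ := hx.isRegularPoint_iff.1 hp
    rw [eval_rename, Sum.elim_comp_inr]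
    exact ((hx.specializes_iff_mem_gradSpan hxy hs hr _).2 (perpTangent_iff.1 hq)).snd f hfy
  rwa [eval_rename, Sum.elim_comp_inr] at hvan

theorem aeval_eq_zero_of_mem_dualEquations (hx : IsGenericPoint S x) (hxy : ConormalPair ℂ x y)
    (hy : y ≠ 0) {f : MvPolynomial σ ℂ} (hf : f ∈ dualEquations S) : aeval y f = 0 := by
  obtain ⟨i, hi⟩ := Function.ne_iff.1 hx.ne_zero
  obtain ⟨j, hj⟩ := Function.ne_iff.1 hy
  obtain ⟨δ, hδ, hreg⟩ := hx.exists_forall_finrank_gradSpan_eq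
  obtain ⟨F, hFS, hli⟩ := hx.exists_fin_linearIndependent
  obtain ⟨⟨d, hd⟩, hvan⟩ := hf
  have hxi : x i ≠ 0 := hi
  have hyj : y j ≠ 0 := hj
  suffices h : aeval x (δ * X i) * aeval y (X j * f) = 0 by simpa [hδ, hxi, hyj] using h
  rw [← aeval_rename_inl_mul_rename_inr,
    hxy.aeval_eq_zero_iff (fun l => hx.aeval_eq_zero (hFS l)) hli rfl]
  intro p hp c
  by_contra hne
  rw [aeval_rename_inl_mul_rename_inr] at hne
  simp only [map_mul, aeval_X, ← ne_eq, mul_ne_zero_iff] at hne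
  obtain ⟨⟨hδp, hpi⟩, hbj, hfb⟩ := hne
  have hp0 : p ≠ 0 := fun h => hpi (congrFun h i)
  have hb0 : gradComb F p c ≠ 0 := fun h => hbj (congrFun h j)
  have hb : gradComb F p c ∈ gradSpan S p := Submodule.sum_mem _ fun l _ =>
    Submodule.smul_mem _ _ (Submodule.subset_span ⟨F l, hFS l, rfl⟩)
  obtain ⟨t, ht, htb⟩ := exists_rep_mk_eq _ hb0
  have h0 : aeval (Projectivization.mk ℂ _ hb0).rep f = 0 := hvan _ <|
    mk_mem_dualVariety hx.homog hp0 ((hx.isRegularPoint_mk_iff hp0).2 ⟨hp, hreg p hp hδp⟩) hb0 hb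
  rw [htb, aeval_smul_of_isHomogeneous hd] at h0
  exact hfb ((smul_eq_zero.1 h0).resolve_left (pow_ne_zero _ ht))

theorem mem_dualEquations_iff (hx : IsGenericPoint S x) (hxy : ConormalPair ℂ x y) (hy : y ≠ 0)
    {f : MvPolynomial σ ℂ} : f ∈ dualEquations S ↔ IsHomog f ∧ aeval y f = 0 :=
  ⟨fun hf => ⟨hf.1, hx.aeval_eq_zero_of_mem_dualEquations hxy hy hf⟩,
    fun hf => ⟨hf.1, fun _ hb => hx.specializes_rep_of_mem_dualVariety hxy hb hf.1 hf.2⟩⟩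

theorem homogeneousComponent_mem_dualEquations (hx : IsGenericPoint S x)
    (hxy : ConormalPair ℂ x y) (hy : y ≠ 0) {f : MvPolynomial σ ℂ} (hf : aeval y f = 0) (d : ℕ) :
    homogeneousComponent d f ∈ dualEquations S := by
  refine (hx.mem_dualEquations_iff hxy hy).2 ⟨⟨d, homogeneousComponent_isHomogeneous d f⟩,
    aeval_homogeneousComponent_eq_zero (k := ℂ) (fun t _ => ?_) d⟩
  have := hx.aeval_smul_smul_eq_zero hxy (H := rename Sum.inr f) (s := 1)
    (by rwa [aeval_rename, Sum.elim_comp_inr]) t one_ne_zero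
  rwa [aeval_rename, Sum.elim_comp_inr] at this

theorem dual (hx : IsGenericPoint S x) (hxy : ConormalPair ℂ x y) (hy : y ≠ 0) :
    IsGenericPoint (dualEquations S) y where
  homog f hf := hf.1
  forall_aeval_eq_zero_iff b := by
    refine ⟨fun h f hf => ?_, fun h f hf => h f ((hx.mem_dualEquations_iff hxy hy).1 hf).2⟩
    rw [← sum_homogeneousComponent f, map_sum]
    exact Finset.sum_eq_zero fun d _ => h _ (hx.homogeneousComponent_mem_dualEquations hxy hy hf d)
  gradSpan_eq := by
    refine le_antisymm (Submodule.span_mono ?_) (Submodule.span_le.2 ?_)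
    · rintro _ ⟨f, hf, rfl⟩
      exact ⟨f, ((hx.mem_dualEquations_iff hxy hy).1 hf).2, rfl⟩
    · rintro _ ⟨f, hf, rfl⟩
      have hsum : grad f y =
          ∑ d ∈ Finset.range (f.totalDegree + 1), grad (homogeneousComponent d f) y := by
        conv_lhs => rw [← sum_homogeneousComponent f]
        ext i
        simp [grad]
      rw [hsum]
      exact Submodule.sum_mem _ fun d _ => Submodule.subset_span
        ⟨_, hx.homogeneousComponent_mem_dualEquations hxy hy hf d, rfl⟩
  ne_zero := hy

end IsGenericPoint

end DualVariety

section ProductEquation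

variable {σ τ κ k E : Type*} [Field k] [Field E] [Algebra k E]

theorem exists_forall_aeval_eq_zero_of_not_algebraicIndependent {z : τ → E}
    {h : MvPolynomial τ k} (hh : aeval z h ≠ 0) (g : κ → MvPolynomial τ k)
    (hdep : ¬ AlgebraicIndependent k fun o : Option κ => aeval z (o.elim h g)) :
    ∃ Φ : MvPolynomial κ k, Φ ≠ 0 ∧ ∀ q : τ → k, Specializes z q → aeval q h = 0 →
      aeval (fun i => aeval q (g i)) Φ = 0 := by
  let φ : MvPolynomial κ k →ₐ[k] E := (aeval z).comp (aeval g)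
  let _ : Algebra (MvPolynomial κ k) E := φ.toAlgebra
  have : IsScalarTower k (MvPolynomial κ k) E := .of_algebraMap_eq' φ.comp_algebraMap.symm
  have halg : IsAlgebraic (MvPolynomial κ k) (aeval z h) := by
    obtain ⟨Ψ, hΨ, hΨ0⟩ : ∃ Ψ : MvPolynomial (Option κ) k,
        aeval (fun o : Option κ => aeval z (o.elim h g)) Ψ = 0 ∧ Ψ ≠ 0 := by
      simpa [algebraicIndependent_iff] using hdep
    have hcomp : ((Polynomial.aeval (aeval z h)).restrictScalars k).comp
        (optionEquivLeft k κ).toAlgHom = aeval fun o : Option κ => aeval z (o.elim h g) := by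
      refine algHom_ext fun o => ?_
      cases o with
      | none => simp
      | some i => simp [RingHom.algebraMap_toAlgebra, φ]
    exact ⟨optionEquivLeft k κ Ψ, by simpa using hΨ0, (DFunLike.congr_fun hcomp Ψ).trans hΨ⟩
  obtain ⟨q, hq0, hq⟩ :=
    halg.exists_nonzero_coeff_and_aeval_eq_zero (mem_nonZeroDivisors_of_ne_zero hh)
  refine ⟨q.coeff 0, hq0, fun p hp hhp => ?_⟩
  have h0 := hp (q.eval₂ (aeval g : MvPolynomial κ k →ₐ[k] _).toRingHom h)
    ((Polynomial.hom_eval₂ q _ (aeval z : _ →ₐ[k] E).toRingHom h).trans hq)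
  have hcoeff : (aeval p).comp (aeval g) (q.coeff 0) = 0 := by
    rw [← h0]
    refine .trans ?_ (Polynomial.hom_eval₂ q _ (aeval p : _ →ₐ[k] k).toRingHom h).symm
    exact (Polynomial.eval₂_at_zero _).symm.trans (congrArg (Polynomial.eval₂ _ · q) hhp.symm)
  rwa [comp_aeval] at hcoeff

theorem exists_forall_eval_eq_zero_of_infinite {Φ : MvPolynomial (Option κ) k} (hΦ : Φ ≠ 0) :
    ∃ G : MvPolynomial κ k, G ≠ 0 ∧ ∀ c : κ → k,
      {t | eval (fun o : Option κ => o.elim t c) Φ = 0}.Infinite → eval c G = 0 := by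
  refine ⟨(optionEquivLeft k κ Φ).leadingCoeff, by simpa using hΦ, fun c hc => ?_⟩
  simp only [optionEquivLeft_elim_eval] at hc
  simpa [Polynomial.leadingCoeff] using
    congrArg (Polynomial.coeff · (optionEquivLeft k κ Φ).natDegree)
      (Polynomial.eq_zero_of_infinite_isRoot _ hc)

theorem ConormalPair.exists_forall_eval_mul_eq_zero [Fintype σ] [Infinite k] [Fintype κ]
    {x y : σ → E} (hxy : ConormalPair k x y) (ι : κ → σ)
    (hκ : Fintype.card σ ≤ Fintype.card κ + 1) (i₀ : σ) {h : MvPolynomial (σ ⊕ σ) k}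
    (hh : aeval (Sum.elim x y) h ≠ 0) :
    ∃ G : MvPolynomial κ k, G ≠ 0 ∧ ∀ p b : σ → k, p i₀ ≠ 0 →
      (∀ t : k, t ≠ 0 → Specializes (Sum.elim x y) (Sum.elim (t • p) (t⁻¹ • b)) ∧
        aeval (Sum.elim (t • p) (t⁻¹ • b)) h = 0) →
      eval (fun j => p (ι j) * b (ι j)) G = 0 := by
  let g : Option κ → MvPolynomial (σ ⊕ σ) k := fun o =>
    o.elim (X (Sum.inl i₀)) fun j => X (Sum.inl (ι j)) * X (Sum.inr (ι j))
  have hdep : ¬ AlgebraicIndependent k fun o : Option (Option κ) =>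
      aeval (Sum.elim x y) (o.elim h g) := fun hg => by
    have hcard := hg.lift_cardinalMk_le_trdeg
    rw [hxy.trdeg_eq] at hcard
    simp only [Cardinal.mk_fintype, Cardinal.lift_natCast, Nat.cast_le, Fintype.card_option]
      at hcard
    omega
  obtain ⟨Φ, hΦ, hΦ0⟩ := exists_forall_aeval_eq_zero_of_not_algebraicIndependent hh g hdep
  obtain ⟨G, hG, hG0⟩ := exists_forall_eval_eq_zero_of_infinite hΦ
  refine ⟨G, hG, fun p b hp hz => hG0 _ <| ((Set.finite_singleton (0 : k)).infinite_compl.image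
    (mul_left_injective₀ hp).injOn).mono ?_⟩
  rintro _ ⟨t, ht, rfl⟩
  obtain ⟨hspec, hh0⟩ := hz t ht
  have ht0 : t ≠ 0 := ht
  have hg : (fun o : Option κ => o.elim (t * p i₀) fun j => p (ι j) * b (ι j)) =
      fun o => aeval (Sum.elim (t • p) (t⁻¹ • b)) (g o) := by
    funext o
    cases o with
    | none => simp [g]
    | some j =>
      simp only [g, Option.elim_some, map_mul, aeval_X, Sum.elim_inl, Sum.elim_inr, Pi.smul_apply,
        smul_eq_mul]
      rw [mul_mul_mul_comm, mul_inv_cancel₀ ht0, one_mul]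
  exact (congrArg (eval · Φ) hg).trans (hΦ0 _ hspec hh0)

end ProductEquation

section Irreducible

variable {σ τ : Type} {S : Set (MvPolynomial σ ℂ)}

theorem eval_smul_eq_zero_iff {f : MvPolynomial σ ℂ} (hf : IsHomog f) {t : ℂ} (ht : t ≠ 0)
    {v : σ → ℂ} : eval (t • v) f = 0 ↔ eval v f = 0 := by
  obtain ⟨d, hd⟩ := hf
  have h : eval (t • v) f = t ^ d * eval v f := aeval_smul_of_isHomogeneous hd t v
  rw [h, mul_eq_zero_iff_left (pow_ne_zero d ht)]

theorem mk_mem_zeroLocus_iff (hS : ∀ f ∈ S, IsHomog f) {v : σ → ℂ} (hv : v ≠ 0) :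
    Projectivization.mk ℂ v hv ∈ zeroLocus S ↔ ∀ f ∈ S, eval v f = 0 := by
  obtain ⟨t, ht, hrep⟩ := exists_rep_mk_eq v hv
  refine forall₂_congr fun f hf => ?_
  rw [hrep, eval_smul_eq_zero_iff (hS f hf) ht]

theorem mem_radical_span_of_zeroLocus_subset [Finite σ] (hS : ∀ f ∈ S, IsHomog f)
    (hne : (zeroLocus S).Nonempty) {a : MvPolynomial σ ℂ} (ha : IsHomog a)
    (hSa : zeroLocus S ⊆ zeroLocus {a}) : a ∈ (Ideal.span S).radical := by
  refine mem_radical_span_iff.2 fun v hv => ?_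
  rcases eq_or_ne v 0 with rfl | hv0
  · obtain ⟨⟨p, hp⟩, d, hd⟩ := And.intro hne ha
    have hpa : aeval p.rep a = 0 := hSa hp a rfl
    rw [← zero_smul ℂ p.rep, aeval_smul_of_isHomogeneous hd, hpa, smul_zero]
  · have hmem := hSa ((mk_mem_zeroLocus_iff hS hv0).2 hv)
    exact (mk_mem_zeroLocus_iff (by simpa using ha) hv0).1 hmem a rfl

theorem homogeneousComponent_mem_radical_span [Finite σ] (hS : ∀ f ∈ S, IsHomog f)
    {h : MvPolynomial σ ℂ} (hh : h ∈ (Ideal.span S).radical) (d : ℕ) :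
    homogeneousComponent d h ∈ (Ideal.span S).radical := by
  rw [mem_radical_span_iff] at hh ⊢
  refine fun v hv => aeval_homogeneousComponent_eq_zero (k := ℂ) (fun t _ => hh _ fun f hf => ?_) d
  obtain ⟨e, he⟩ := hS f hf
  rw [aeval_smul_of_isHomogeneous he, hv f hf, smul_zero]

theorem isPrime_radical_span [Finite σ] (hS : ∀ f ∈ S, IsHomog f) (hirr : IsIrred (zeroLocus S)) :
    (Ideal.span S).radical.IsPrime := by
  obtain ⟨hne, hcover⟩ := hirr
  let : GradedAlgebra (homogeneousSubmodule σ ℂ) := gradedAlgebra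
  have hI : (Ideal.span S).radical.IsHomogeneous (homogeneousSubmodule σ ℂ) := fun d h hh => by
    have := homogeneousComponent_mem_radical_span hS hh d
    rwa [← decomposition.decompose'_apply] at this
  refine hI.isPrime_of_homogeneous_mem_or_mem ?_ ?_
  · obtain ⟨p, hp⟩ := hne
    rw [Ne, Ideal.eq_top_iff_one, mem_radical_span_iff]
    intro h
    simpa using h p.rep hp
  · rintro a b (ha : IsHomog a) (hb : IsHomog b) hab
    refine (hcover (zeroLocus {a}) (zeroLocus {b}) ⟨{a}, by simpa using ha, rfl⟩
      ⟨{b}, by simpa using hb, rfl⟩ fun p hp => ?_).imp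
      (mem_radical_span_of_zeroLocus_subset hS hne ha)
      (mem_radical_span_of_zeroLocus_subset hS hne hb)
    have h := mem_radical_span_iff.1 hab p.rep hp
    rw [map_mul, mul_eq_zero] at h
    exact h.imp (fun h f hf => hf ▸ h) fun h f hf => hf ▸ h

theorem IsZariskiClosed.preimage_map [Finite σ] [Finite τ] {L : (σ → ℂ) →ₗ[ℂ] (τ → ℂ)}
    (hL : Function.Injective L) {A : Set (PSpace τ)} (hA : IsZariskiClosed A) :
    IsZariskiClosed (Projectivization.map L hL ⁻¹' A) := by
  classical
  have := Fintype.ofFinite σ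
  have := Fintype.ofFinite τ
  obtain ⟨T, hT, rfl⟩ := hA
  let M := LinearMap.toMatrix' L
  have heval (v : σ → ℂ) (f : MvPolynomial τ ℂ) :
      aeval v (aeval M.toMvPolynomial f) = eval (L v) f := by
    have hLv : L v = fun j => aeval v (M.toMvPolynomial j) := by
      funext j
      exact (congrFun (LinearMap.toMatrix'_mulVec L v) j).symm.trans
        (Matrix.toMvPolynomial_eval_eq_apply M j v).symm
    rw [hLv, ← AlgHom.comp_apply, comp_aeval]
    rfl
  refine ⟨aeval M.toMvPolynomial '' T, ?_, ?_⟩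
  · rintro _ ⟨f, hf, rfl⟩
    obtain ⟨d, hd⟩ := hT f hf
    exact ⟨1 * d, hd.aeval _ M.toMvPolynomial_isHomogeneous⟩
  · ext p
    conv_lhs => rw [← p.mk_rep]
    rw [Set.mem_preimage, Projectivization.map_mk, mk_mem_zeroLocus_iff hT]
    refine .trans (forall₂_congr fun f _ => ?_) Set.forall_mem_image.symm
    rw [← heval]
    rfl

theorem IsIrred.image_map [Finite σ] [Finite τ] {Y : Set (PSpace σ)} (hY : IsIrred Y)
    {L : (σ → ℂ) →ₗ[ℂ] (τ → ℂ)} (hL : Function.Injective L) :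
    IsIrred (Projectivization.map L hL '' Y) := by
  refine ⟨hY.1.image _, fun A B hA hB hAB => ?_⟩
  simp only [Set.image_subset_iff, Set.preimage_union] at hAB ⊢
  exact hY.2 _ _ (hA.preimage_map hL) (hB.preimage_map hL) hAB

end Irreducible

section GenericPair

variable {σ : Type} [Fintype σ] {S : Set (MvPolynomial σ ℂ)}

theorem isGenericPoint_of_isRegularPoint {E : Type*} [Field E] [Algebra ℂ E] {x : σ → E}
    (hS : ∀ f ∈ S, IsHomog f) (hx : (Ideal.span S).radical = pointIdeal ℂ x) {p : PSpace σ}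
    (hp : IsRegularPoint S p) : IsGenericPoint S x := by
  have hSx (f : MvPolynomial σ ℂ) (hf : f ∈ S) : aeval x f = 0 :=
    hx.le (Ideal.le_radical (Ideal.subset_span hf))
  have hspec (q : σ → ℂ) : (∀ f ∈ S, aeval q f = 0) ↔ Specializes x q :=
    ⟨fun hq f hf => mem_radical_span_iff.1 (hx.ge hf) q hq, fun hq f hf => hq f (hSx f hf)⟩
  obtain ⟨hpS, hrank⟩ := (isRegularPoint_iff_of_radical_span_eq hx).1 hp
  have hpx := (hspec p.rep).1 hpS
  refine ⟨hS, hspec, Submodule.eq_of_le_of_finrank_le (Submodule.span_mono ?_) ?_, ?_⟩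
  · rintro _ ⟨f, hf, rfl⟩
    exact ⟨f, hSx f hf, rfl⟩
  · exact hrank ▸ finrank_gradSpan_le_of_specializes hpx
  · rintro rfl
    exact p.rep_nonzero (funext fun i => by simpa using hpx (X i) (by simp))

theorem exists_isGenericPoint_conormalPair (hS : ∀ f ∈ S, IsHomog f)
    (hirr : IsIrred (zeroLocus S)) (hdual : (dualVariety S).Nonempty) :
    ∃ (E : Type) (_ : Field E) (_ : Algebra ℂ E) (x y : σ → E),
      IsGenericPoint S x ∧ IsGenericPoint (dualEquations S) y ∧ ConormalPair ℂ x y := by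
  have := isPrime_radical_span hS hirr
  obtain ⟨K, _, _, x₀, hx₀, hadjoin⟩ := exists_pointIdeal_eq (Ideal.span S).radical
  have hhom (h : MvPolynomial σ ℂ) (hh : aeval x₀ h = 0) (d : ℕ) :
      aeval x₀ (homogeneousComponent d h) = 0 :=
    hx₀.ge (homogeneousComponent_mem_radical_span hS (hx₀.le hh) d)
  obtain ⟨E, _, _, x, y, hx, hxy⟩ := exists_conormalPair hadjoin hhom
  obtain ⟨p, hp⟩ := exists_isRegularPoint_of_dualVariety_nonempty hdual
  have hgen := isGenericPoint_of_isRegularPoint hS (hx₀.symm.trans hx.symm) hp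
  refine ⟨E, _, _, x, y, hgen, hgen.dual hxy ?_, hxy⟩
  obtain ⟨b, hb⟩ := hdual
  rintro rfl
  exact b.rep_nonzero <| funext fun i => by
    simpa using hgen.specializes_rep_of_mem_dualVariety hxy hb ⟨1, isHomogeneous_X ℂ i⟩ (by simp)

end GenericPair

section CriticalPoint

variable {σ : Type} [Fintype σ] {E : Type*} [Field E] [Algebra ℂ E]
  {S S' : Set (MvPolynomial σ ℂ)} {x y : σ → E} {w : σ → ℂ} {p b : PSpace σ}

omit [Fintype σ] in
theorem ProductRel.symm (h : ProductRel w p b) : ProductRel w b p := by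
  obtain ⟨c, hc, h⟩ := h
  exact ⟨c, hc, fun i => by rw [mul_comm, h]⟩

omit [Fintype σ] in
theorem productRel_iff_exists_rep_eq (hp : ∀ i, p.rep i ≠ 0) :
    ProductRel w p b ↔ ∃ c : ℂ, c ≠ 0 ∧ b.rep = c • (w / p.rep) := by
  refine exists_congr fun c => and_congr_right fun _ => ?_
  rw [funext_iff]
  refine forall_congr' fun i => ?_
  rw [Pi.smul_apply, smul_eq_mul, Pi.div_apply, mul_div, eq_div_iff (hp i), mul_comm]

omit [Fintype σ] in
theorem ProductRel.rep_ne_zero (h : ProductRel w p b) (hw : ∀ i, w i ≠ 0) (i : σ) :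
    p.rep i ≠ 0 := by
  obtain ⟨c, hc, h⟩ := h
  exact left_ne_zero_of_mul (h i ▸ mul_ne_zero hc (hw i))

omit [Fintype σ] in
theorem div_rep_ne_zero (hw : ∀ i, w i ≠ 0) (hp : ∀ i, p.rep i ≠ 0) : w / p.rep ≠ 0 := by
  obtain ⟨i, -⟩ := Function.ne_iff.1 p.rep_nonzero
  exact fun h => div_ne_zero (hw i) (hp i) (congrFun h i)

omit [Fintype σ] in
theorem productRel_mk_div_rep (hw : ∀ i, w i ≠ 0) (hp : ∀ i, p.rep i ≠ 0) :
    ProductRel w p (Projectivization.mk ℂ (w / p.rep) (div_rep_ne_zero hw hp)) :=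
  (productRel_iff_exists_rep_eq hp).2 (exists_rep_mk_eq _ _)

omit [Fintype σ] in
theorem ProductRel.eq_mk_div_rep (h : ProductRel w p b) (hw : ∀ i, w i ≠ 0)
    (hp : ∀ i, p.rep i ≠ 0) :
    b = Projectivization.mk ℂ (w / p.rep) (div_rep_ne_zero hw hp) := by
  obtain ⟨c, -, hb⟩ := (productRel_iff_exists_rep_eq hp).1 h
  rw [← b.mk_rep, Projectivization.mk_eq_mk_iff']
  exact ⟨c, hb.symm⟩

theorem isCriticalPoint_iff_rep_mem_gradSpan (hw : ∀ i, w i ≠ 0) (h : ProductRel w p b)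
    (hp : IsRegularPoint S p) : IsCriticalPoint S w p ↔ b.rep ∈ gradSpan S p.rep := by
  have hp0 := h.rep_ne_zero hw
  obtain ⟨c, hc, hb⟩ := (productRel_iff_exists_rep_eq hp0).1 h
  rw [hb, Submodule.smul_mem_iff _ hc, ← perpTangent_iff]
  exact ⟨fun h => h.2.2, fun h => ⟨hp, hp0, h⟩⟩

theorem isCriticalPoint_iff_of_productRel (hx : IsGenericPoint S x) (hy : IsGenericPoint S' y)
    (hxy : ConormalPair ℂ x y) (hw : ∀ i, w i ≠ 0) (h : ProductRel w p b)
    (hp : IsRegularPoint S p) (hb : IsRegularPoint S' b) :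
    IsCriticalPoint S w p ↔ IsCriticalPoint S' w b := by
  obtain ⟨hpx, hpr⟩ := hx.isRegularPoint_iff.1 hp
  obtain ⟨hby, hbr⟩ := hy.isRegularPoint_iff.1 hb
  rw [isCriticalPoint_iff_rep_mem_gradSpan hw h hp,
    isCriticalPoint_iff_rep_mem_gradSpan hw h.symm hb,
    ← hx.specializes_iff_mem_gradSpan hxy hpx hpr,
    ← hy.specializes_iff_mem_gradSpan hxy.symm hby hbr]
  exact ⟨specializes_sumElim_swap, specializes_sumElim_swap⟩

theorem IsCriticalPoint.specializes (hp : IsCriticalPoint S w p) (hx : IsGenericPoint S x)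
    (hxy : ConormalPair ℂ x y) : Specializes (Sum.elim x y) (Sum.elim p.rep (w / p.rep)) := by
  obtain ⟨hreg, -, hperp⟩ := hp
  obtain ⟨hpx, hpr⟩ := hx.isRegularPoint_iff.1 hreg
  exact (hx.specializes_iff_mem_gradSpan hxy hpx hpr _).2 (perpTangent_iff.1 hperp)

theorem IsCriticalPoint.existsUnique_productRel (hp : IsCriticalPoint S w p)
    (hx : IsGenericPoint S x) (hy : IsGenericPoint S' y) (hxy : ConormalPair ℂ x y)
    (hw : ∀ i, w i ≠ 0) (hreg : Module.finrank ℂ (gradSpan S' (w / p.rep)) =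
      Module.finrank E (conormalSpace ℂ y)) :
    ∃! b : {b // IsCriticalPoint S' w b}, ProductRel w p b := by
  have hp0 := hp.2.1
  have hrel := productRel_mk_div_rep hw hp0
  have hb := (hy.isRegularPoint_mk_iff (div_rep_ne_zero hw hp0)).2
    ⟨(hp.specializes hx hxy).snd, hreg⟩
  exact ⟨⟨_, (isCriticalPoint_iff_of_productRel hx hy hxy hw hrel hp.1 hb).1 hp⟩, hrel,
    fun b h => Subtype.ext (h.eq_mk_div_rep hw hp0)⟩

theorem exists_forall_finrank_gradSpan_eq_of_conormalPair (hx : IsGenericPoint S x)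
    (hy : IsGenericPoint S' y) (hxy : ConormalPair ℂ x y) {κ : Type*} [Fintype κ] (ι : κ → σ)
    (hκ : Fintype.card σ ≤ Fintype.card κ + 1) (i₀ : σ) :
    ∃ G : MvPolynomial κ ℂ, G ≠ 0 ∧ ∀ p b : σ → ℂ,
      Specializes (Sum.elim x y) (Sum.elim p b) → p i₀ ≠ 0 →
      eval (fun j => p (ι j) * b (ι j)) G ≠ 0 →
      Module.finrank ℂ (gradSpan S p) = Module.finrank E (conormalSpace ℂ x) ∧
      Module.finrank ℂ (gradSpan S' b) = Module.finrank E (conormalSpace ℂ y) := by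
  obtain ⟨δ, hδ, hδreg⟩ := hx.exists_forall_finrank_gradSpan_eq
  obtain ⟨ε, hε, hεreg⟩ := hy.exists_forall_finrank_gradSpan_eq
  obtain ⟨G, hG, hG0⟩ := hxy.exists_forall_eval_mul_eq_zero ι hκ i₀
    (h := rename Sum.inl δ * rename Sum.inr ε)
    (by rw [aeval_rename_inl_mul_rename_inr]; exact mul_ne_zero hδ hε)
  refine ⟨G, hG, fun p b hpb hp hne => ?_⟩
  contrapose! hne
  refine hG0 p b hp fun t ht => ?_
  have hspec := hx.specializes_smul_smul hxy hpb t⁻¹ ht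
  refine ⟨hspec, ?_⟩
  rw [aeval_rename_inl_mul_rename_inr]
  by_contra h0
  obtain ⟨hδ0, hε0⟩ := mul_ne_zero_iff.1 h0
  refine hne ?_ ?_
  · rw [← hδreg _ hspec.fst hδ0, gradSpan_smul hx.homog _ ht]
  · rw [← hεreg _ hspec.snd hε0, gradSpan_smul hy.homog _ (inv_ne_zero ht)]

theorem exists_forall_existsUnique_productRel (hx : IsGenericPoint S x)
    (hy : IsGenericPoint S' y) (hxy : ConormalPair ℂ x y) {κ : Type*} [Fintype κ] (ι : κ → σ)
    (hκ : Fintype.card σ ≤ Fintype.card κ + 1) :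
    ∃ G : MvPolynomial κ ℂ, G ≠ 0 ∧ ∀ w : σ → ℂ, (∀ i, w i ≠ 0) → eval (w ∘ ι) G ≠ 0 →
      (∀ p, IsCriticalPoint S w p → ∃! b : {b // IsCriticalPoint S' w b}, ProductRel w p b) ∧
      (∀ b, IsCriticalPoint S' w b → ∃! p : {p // IsCriticalPoint S w p}, ProductRel w p b) := by
  obtain ⟨i₀, -⟩ := Function.ne_iff.1 hx.ne_zero
  obtain ⟨G, hG, hreg⟩ := exists_forall_finrank_gradSpan_eq_of_conormalPair hx hy hxy ι hκ i₀
  refine ⟨G, hG, fun w hw hGw => ⟨fun p hp => ?_, fun b hb => ?_⟩⟩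
  · have hprod : (fun j => p.rep (ι j) * (w / p.rep) (ι j)) = w ∘ ι :=
      funext fun j => mul_div_cancel₀ _ (hp.2.1 (ι j))
    exact hp.existsUnique_productRel hx hy hxy hw
      (hreg _ _ (hp.specializes hx hxy) (hp.2.1 i₀) (hprod ▸ hGw)).2
  · have hprod : (fun j => (w / b.rep) (ι j) * b.rep (ι j)) = w ∘ ι :=
      funext fun j => div_mul_cancel₀ _ (hb.2.1 (ι j))
    obtain ⟨p, hp, huniq⟩ := hb.existsUnique_productRel hy hx hxy.symm hw
      (hreg _ _ (specializes_sumElim_swap (hb.specializes hy hxy.symm))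
        (div_ne_zero (hw i₀) (hb.2.1 i₀)) (hprod ▸ hGw)).1
    exact ⟨p, hp.symm, fun p' h => huniq p' h.symm⟩

end CriticalPoint

section DualNonempty

variable {σ : Type} [Fintype σ] {S : Set (MvPolynomial σ ℂ)} {w : σ → ℂ} {p b : PSpace σ}

theorem IsRegularPoint.dualVariety_nonempty (hb : IsRegularPoint (dualEquations S) b) :
    (dualVariety S).Nonempty := by
  by_contra h
  rw [Set.not_nonempty_iff_eq_empty] at h
  simpa using hb.1 1 ⟨⟨0, isHomogeneous_one _ _⟩, by simp [h]⟩

theorem IsCriticalPoint.dualVariety_nonempty (hp : IsCriticalPoint S w p)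
    (hS : ∀ f ∈ S, IsHomog f) (hw : ∀ i, w i ≠ 0) : (dualVariety S).Nonempty :=
  ⟨_, mk_mem_dualVariety hS p.rep_nonzero (p.mk_rep.symm ▸ hp.1) (div_rep_ne_zero hw hp.2.1)
    (perpTangent_iff.1 hp.2.2)⟩

end DualNonempty

section Duality

theorem exists_equiv_of_existsUnique {α β : Type*} {r : α → β → Prop} (h : ∀ a, ∃! b, r a b)
    (h' : ∀ b, ∃! a, r a b) : ∃ e : α ≃ β, ∀ a b, e a = b ↔ r a b := by
  choose f hf huniq using h
  have hbij : Function.Bijective f := by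
    refine ⟨fun a a' haa' => (h' (f a)).unique (hf a) (haa' ▸ hf a'), fun b => ?_⟩
    obtain ⟨a, ha, -⟩ := h' b
    exact ⟨a, (huniq a b ha).symm⟩
  exact ⟨.ofBijective f hbij, fun a b => ⟨fun hab => hab ▸ hf a, fun hab => (huniq a b hab).symm⟩⟩

variable {σ : Type} [Fintype σ] {S : Set (MvPolynomial σ ℂ)} {w : σ → ℂ} {p b : PSpace σ}

theorem exists_forall_exists_equiv_criticalPoint (hS : ∀ f ∈ S, IsHomog f)
    (hirr : IsIrred (zeroLocus S)) {κ : Type*} [Fintype κ] (ι : κ → σ)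
    (hκ : Fintype.card σ ≤ Fintype.card κ + 1) :
    ∃ G : MvPolynomial κ ℂ, G ≠ 0 ∧ ∀ w : σ → ℂ, (∀ i, w i ≠ 0) → eval (w ∘ ι) G ≠ 0 →
      ∃ e : {p // IsCriticalPoint S w p} ≃ {b // IsCriticalPoint (dualEquations S) w b},
        ∀ p b, e p = b ↔ ProductRel w p.1 b.1 := by
  by_cases hdual : (dualVariety S).Nonempty
  · obtain ⟨E, _, _, x, y, hx, hy, hxy⟩ := exists_isGenericPoint_conormalPair hS hirr hdual
    obtain ⟨G, hG, h⟩ := exists_forall_existsUnique_productRel hx hy hxy ι hκ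
    refine ⟨G, hG, fun w hw hGw => exists_equiv_of_existsUnique ?_ ?_⟩
    · exact fun p => (h w hw hGw).1 p.1 p.2
    · exact fun b => (h w hw hGw).2 b.1 b.2
  · refine ⟨1, one_ne_zero, fun w hw _ => exists_equiv_of_existsUnique ?_ ?_⟩
    · exact fun p => absurd (p.2.dualVariety_nonempty hS hw) hdual
    · exact fun b => absurd b.2.1.dualVariety_nonempty hdual

theorem isCriticalPoint_iff_isCriticalPoint_dualEquations (hS : ∀ f ∈ S, IsHomog f)
    (hirr : IsIrred (zeroLocus S)) (hw : ∀ i, w i ≠ 0) (h : ProductRel w p b)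
    (hp : IsRegularPoint S p) (hb : IsRegularPoint (dualEquations S) b) :
    IsCriticalPoint S w p ↔ IsCriticalPoint (dualEquations S) w b := by
  obtain ⟨E, _, _, x, y, hx, hy, hxy⟩ :=
    exists_isGenericPoint_conormalPair hS hirr hb.dualVariety_nonempty
  exact isCriticalPoint_iff_of_productRel hx hy hxy hw h hp hb

end Duality

section Monomial

variable {σ : Type} [Fintype σ] {w : σ → ℂ}

theorem mul_mem_monomialValues {p b : σ → ℂ} {c z z' : ℂ} (hsum : ∑ i, w i = 0) (hc : c ≠ 0)
    (h : ∀ i, p i * b i = c * w i) (hz : z ∈ monomialValues w p) (hz' : z' ∈ monomialValues w b) :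
    z * z' ∈ monomialValues w w := by
  obtain ⟨α, hα, rfl⟩ := hz
  obtain ⟨β, hβ, rfl⟩ := hz'
  refine ⟨fun i => α i + β i - Complex.log c, fun i => ?_, ?_⟩
  · rw [Complex.exp_sub, Complex.exp_add, hα, hβ, Complex.exp_log hc, h i,
      mul_div_cancel_left₀ _ hc]
  · simp only [← Complex.exp_add, mul_sub, mul_add, Finset.sum_sub_distrib,
      Finset.sum_add_distrib, ← Finset.sum_mul, hsum, zero_mul, sub_zero]

theorem image2_mul_monomialValues {p b : PSpace σ} (hw : ∀ i, w i ≠ 0) (hsum : ∑ i, w i = 0)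
    (h : ProductRel w p b) :
    Set.image2 (fun y z : ℂ => y * z) (monomialValues w p.rep) (monomialValues w b.rep) =
      monomialValues w w := by
  have hp := h.rep_ne_zero hw
  obtain ⟨c, hc, h⟩ := h
  refine Set.Subset.antisymm (Set.image2_subset_iff.2 fun _ hz _ hz' =>
    mul_mem_monomialValues hsum hc h hz hz') ?_
  rintro _ ⟨γ, hγ, rfl⟩
  refine ⟨_, ⟨fun i => Complex.log (p.rep i), fun i => Complex.exp_log (hp i), rfl⟩, _,
    ⟨fun i => γ i + Complex.log c - Complex.log (p.rep i), fun i => ?_, rfl⟩, ?_⟩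
  · rw [Complex.exp_sub, Complex.exp_add, hγ, Complex.exp_log hc, Complex.exp_log (hp i),
      mul_comm (w i), ← h i, mul_div_cancel_left₀ _ (hp i)]
  · simp only [← Complex.exp_add, mul_sub, mul_add, Finset.sum_sub_distrib,
      Finset.sum_add_distrib, ← Finset.sum_mul, hsum, zero_mul, add_zero, add_sub_cancel]

theorem prod_zpow_eq_zpow_sum {c : ℂ} (hc : c ≠ 0) (m : σ → ℤ) : ∏ i, c ^ m i = c ^ ∑ i, m i := by
  classical
  induction (Finset.univ : Finset σ) using Finset.induction_on with
  | empty => simp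
  | insert i s hi ih => rw [Finset.prod_insert hi, Finset.sum_insert hi, zpow_add₀ hc, ih]

theorem prod_zpow_mul_prod_zpow {p b : PSpace σ} (hsum : ∑ i, w i = 0) (h : ProductRel w p b)
    {m : σ → ℤ} (hm : ∀ i, w i = m i) :
    (∏ i, p.rep i ^ m i) * (∏ i, b.rep i ^ m i) = ∏ i, (m i : ℂ) ^ m i := by
  obtain ⟨c, hc, h⟩ := h
  have hm0 : ∑ i, m i = 0 := by
    simp only [hm] at hsum
    exact_mod_cast hsum
  have hconst : ∏ i, c ^ m i = 1 := by
    rw [prod_zpow_eq_zpow_sum hc, hm0, zpow_zero]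
  simp only [← Finset.prod_mul_distrib, ← mul_zpow, h, hm]
  simp only [mul_zpow, Finset.prod_mul_distrib, hconst, one_mul]

end Monomial

section PrimeEquations

variable {n k : ℕ}

theorem sum_weights (u : Fin (n + 1) → ℂ) : ∑ i, weights u i = 0 := by
  simp [Fin.sum_univ_castSucc, weights]

theorem weights_comp_castSucc (u : Fin (n + 1) → ℂ) : weights u ∘ Fin.castSucc = u := by
  ext i
  simp [weights]

theorem weights_ne_zero {u : Fin (n + 1) → ℂ} (hu : ∀ i, u i ≠ 0) (hs : ∑ i, u i ≠ 0)
    (i : Fin (n + 2)) : weights u i ≠ 0 := by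
  induction i using Fin.lastCases with
  | last => simpa [weights] using hs
  | cast i => simpa [weights] using hu i

theorem isHomog_primeEquations {f : Fin k → MvPolynomial (Fin (n + 1)) ℂ}
    (hhom : ∀ j, IsHomog (f j)) : ∀ g ∈ primeEquations f, IsHomog g := by
  rintro _ (⟨j, rfl⟩ | rfl)
  · obtain ⟨d, hd⟩ := hhom j
    exact ⟨d, hd.rename_isHomogeneous⟩
  · exact ⟨1, (isHomogeneous_X _ _).sub (IsHomogeneous.sum _ _ _ fun i _ => isHomogeneous_X _ _)⟩

/-- The parametrization of the hyperplane `p_s = p_0 + ⋯ + p_n` by the coordinates other than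
`p_s`. -/
def snocSum (n : ℕ) : (Fin (n + 1) → ℂ) →ₗ[ℂ] (Fin (n + 2) → ℂ) where
  toFun v := Fin.snoc (α := fun _ => ℂ) v (∑ i, v i)
  map_add' v v' := by
    ext i
    induction i using Fin.lastCases <;> simp [Finset.sum_add_distrib]
  map_smul' c v := by
    ext i
    induction i using Fin.lastCases <;> simp [Finset.mul_sum]

theorem snocSum_comp_castSucc (v : Fin (n + 1) → ℂ) : snocSum n v ∘ Fin.castSucc = v := by
  ext i
  simp [snocSum]

theorem snocSum_injective : Function.Injective (snocSum n) :=
  Function.LeftInverse.injective (g := (· ∘ Fin.castSucc)) snocSum_comp_castSucc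

theorem forall_mem_primeEquations_iff {f : Fin k → MvPolynomial (Fin (n + 1)) ℂ}
    {v : Fin (n + 2) → ℂ} : (∀ g ∈ primeEquations f, eval v g = 0) ↔
      (∀ j, eval (v ∘ Fin.castSucc) (f j) = 0) ∧ snocSum n (v ∘ Fin.castSucc) = v := by
  have hlast : snocSum n (v ∘ Fin.castSucc) = v ↔
      v (Fin.last (n + 1)) = ∑ i : Fin (n + 1), v i.castSucc := by
    refine ⟨fun h => ?_, fun h => funext fun i => ?_⟩
    · simpa [snocSum] using (congrFun h (Fin.last (n + 1))).symm
    · induction i using Fin.lastCases <;> simp [snocSum, h]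
  simp [primeEquations, or_imp, forall_and, eval_rename, sub_eq_zero, hlast, and_comm]

theorem zeroLocus_primeEquations {f : Fin k → MvPolynomial (Fin (n + 1)) ℂ}
    (hhom : ∀ j, IsHomog (f j)) : zeroLocus (primeEquations f) =
      Projectivization.map (snocSum n) snocSum_injective '' zeroLocus (Set.range f) := by
  have hf : ∀ g ∈ Set.range f, IsHomog g := Set.forall_mem_range.2 hhom
  ext q
  constructor
  · intro hq
    obtain ⟨hq, hsum⟩ := forall_mem_primeEquations_iff.1 hq
    have hne : q.rep ∘ Fin.castSucc ≠ 0 := fun h => q.rep_nonzero (by rw [← hsum, h, map_zero])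
    refine ⟨.mk ℂ _ hne, (mk_mem_zeroLocus_iff hf hne).2 (Set.forall_mem_range.2 hq), ?_⟩
    simp only [Projectivization.map_mk, hsum, q.mk_rep]
  · rintro ⟨p, hp, rfl⟩
    rw [← p.mk_rep, Projectivization.map_mk, mk_mem_zeroLocus_iff (isHomog_primeEquations hhom),
      forall_mem_primeEquations_iff, snocSum_comp_castSucc]
    exact ⟨fun j => hp _ ⟨j, rfl⟩, rfl⟩

theorem isIrred_zeroLocus_primeEquations {f : Fin k → MvPolynomial (Fin (n + 1)) ℂ}
    (hhom : ∀ j, IsHomog (f j)) (hirr : IsIrred (zeroLocus (Set.range f))) :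
    IsIrred (zeroLocus (primeEquations f)) :=
  zeroLocus_primeEquations hhom ▸ hirr.image_map snocSum_injective

end PrimeEquations

end MLDual

end

theorem corollary2p6_general {σ κ : Type} [Fintype σ] [Fintype κ] {S : Set (MvPolynomial σ ℂ)}
    (hS : ∀ f ∈ S, MLDual.IsHomog f) (hirr : MLDual.IsIrred (MLDual.zeroLocus S)) (ι : κ → σ)
    (hκ : Fintype.card σ ≤ Fintype.card κ + 1) :
    (∃ G : MvPolynomial κ ℂ, G ≠ 0 ∧
      ∀ w : σ → ℂ, (∀ i, w i ≠ 0) → MvPolynomial.eval (w ∘ ι) G ≠ 0 →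
        ∃ e : {p // MLDual.IsCriticalPoint S w p} ≃
            {b // MLDual.IsCriticalPoint (MLDual.dualEquations S) w b},
          ∀ p b, e p = b ↔ MLDual.ProductRel w p.1 b.1) ∧
    (∀ w : σ → ℂ, (∀ i, w i ≠ 0) → ∀ p b, MLDual.ProductRel w p b →
      MLDual.IsRegularPoint S p → MLDual.IsRegularPoint (MLDual.dualEquations S) b →
        (MLDual.IsCriticalPoint S w p ↔
          MLDual.IsCriticalPoint (MLDual.dualEquations S) w b)) ∧
    (∀ w : σ → ℂ, (∀ i, w i ≠ 0) → ∑ i, w i = 0 → ∀ p b, MLDual.ProductRel w p b →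
      Set.image2 (fun y z : ℂ => y * z)
          (MLDual.monomialValues w p.rep) (MLDual.monomialValues w b.rep) =
        MLDual.monomialValues w w ∧
      ∀ m : σ → ℤ, (∀ i, w i = (m i : ℂ)) →
        (∏ i, p.rep i ^ m i) * (∏ i, b.rep i ^ m i) = ∏ i, (m i : ℂ) ^ m i) :=
  ⟨MLDual.exists_forall_exists_equiv_criticalPoint hS hirr ι hκ,
    fun _ hw _ _ h => MLDual.isCriticalPoint_iff_isCriticalPoint_dualEquations hS hirr hw h,
    fun _ hw hsum _ _ h => ⟨MLDual.image2_mul_monomialValues hw hsum h,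
      fun _ => MLDual.prod_zpow_mul_prod_zpow hsum h⟩⟩

theorem corollary2p6 {n k : ℕ} (f : Fin k → MvPolynomial (Fin (n + 1)) ℂ)
    (hhom : ∀ j, MLDual.IsHomog (f j))
    (hirr : MLDual.IsIrred (MLDual.zeroLocus (Set.range f)))
    (hred : MLDual.IsGenericallyReduced (Set.range f)) :
    -- for generic data `u` the relation is a bijection between the two sets of critical points
    (∃ G : MvPolynomial (Fin (n + 1)) ℂ, G ≠ 0 ∧
      ∀ u : Fin (n + 1) → ℂ, (∀ i, u i ≠ 0) → ∑ i, u i ≠ 0 → MvPolynomial.eval u G ≠ 0 →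
        ∃ e : {p // MLDual.IsCriticalPoint (MLDual.primeEquations f) (MLDual.weights u) p} ≃
            {b // MLDual.IsCriticalPoint (MLDual.dualEquations (MLDual.primeEquations f))
              (MLDual.weights u) b},
          ∀ p b, e p = b ↔ MLDual.ProductRel (MLDual.weights u) p.1 b.1) ∧
    -- for arbitrary data `u` the same holds for pairs of regular points
    (∀ u : Fin (n + 1) → ℂ, (∀ i, u i ≠ 0) → ∑ i, u i ≠ 0 →
      ∀ p b, MLDual.ProductRel (MLDual.weights u) p b →
        MLDual.IsRegularPoint (MLDual.primeEquations f) p →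
        MLDual.IsRegularPoint (MLDual.dualEquations (MLDual.primeEquations f)) b →
        (MLDual.IsCriticalPoint (MLDual.primeEquations f) (MLDual.weights u) p ↔
          MLDual.IsCriticalPoint (MLDual.dualEquations (MLDual.primeEquations f))
            (MLDual.weights u) b)) ∧
    -- the product of the two monomials is constant on pairs of critical points
    (∀ u : Fin (n + 1) → ℂ, (∀ i, u i ≠ 0) → ∑ i, u i ≠ 0 →
      ∀ p b, MLDual.ProductRel (MLDual.weights u) p b →
        MLDual.IsCriticalPoint (MLDual.primeEquations f) (MLDual.weights u) p →
        MLDual.IsCriticalPoint (MLDual.dualEquations (MLDual.primeEquations f))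
          (MLDual.weights u) b →
        Set.image2 (fun y z : ℂ => y * z)
            (MLDual.monomialValues (MLDual.weights u) p.rep)
            (MLDual.monomialValues (MLDual.weights u) b.rep) =
          MLDual.monomialValues (MLDual.weights u) (MLDual.weights u) ∧
        ∀ m : Fin (n + 2) → ℤ, (∀ i, MLDual.weights u i = (m i : ℂ)) →
          (∏ i, p.rep i ^ m i) * (∏ i, b.rep i ^ m i) = ∏ i, (m i : ℂ) ^ m i) := by
  obtain ⟨⟨G, hG, hequiv⟩, hcrit, hprod⟩ := corollary2p6_general
    (MLDual.isHomog_primeEquations hhom) (MLDual.isIrred_zeroLocus_primeEquations hhom hirr)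
    Fin.castSucc (by simp)
  refine ⟨⟨G, hG, fun u hu hs hGu => hequiv _ (MLDual.weights_ne_zero hu hs) ?_⟩,
    fun u hu hs => hcrit _ (MLDual.weights_ne_zero hu hs),
    fun u hu hs p b h _ _ => hprod _ (MLDual.weights_ne_zero hu hs) (MLDual.sum_weights u) p b h⟩
  rwa [MLDual.weights_comp_castSucc]
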